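/- **Proposition (projectivity of the one-forms on a braided orbit).** Let $q\in\mathbb C^\times$ be generic, i.e. $q^k\neq 1$ for all integers $k\ge 1$, and let $V=\mathbb C^N$. Let $R:V\otimes V\to V\otimes V$ be a Hecke symmetry: $$R_{12}R_{23}R_{12}=R_{23}R_{12}R_{23},\qquad (qI-R)(q^{-1}I+R)=0.$$ Let $R$ be skew-invertible, i.e. let there be an operator $\Psi$ on $V\otimes V$ with $\sum_{a,b}R_{ib}^{ja}\Psi_{ak}^{bn}=\delta_i^n\delta_k^j$ (lower indices number rows, upper indices columns). Put $C_i^j=\sum_k\Psi_{ik}^{jk}$ and $\operatorname{Tr}_R X=\operatorname{Tr}(CX)$. Let $R$ be even of bi-rank $(m|0)$, i.e. the Hilbert–Poincaré series $P_-(t)=\sum_{k\ge0} t^k\dim\Lambda_-^k$ of the $R$-skew-symmetric algebra $\Lambda_-=T(V)/\langle \operatorname{Im}(q^{-1}I+R)\rangle$ is a polynomial of degree $m$. Let $\mathcal L(R)$ be the reflection equation algebra: the unital associative $\mathbb C$-algebra generated by the entries $l_i^j$ of an $N\times N$ matrix $L$ subject to $$R\,(L\otimes I)\,R\,(L\otimes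 I)=(L\otimes I)\,R\,(L\otimes I)\,R .$$ For $\mu=(\mu_1,\dots,\mu_m)\in\mathbb C^m$ and $k\ge1$ let $$\alpha_k(\mu)=q^{-1}\sum_{i=1}^m\mu_i^k\prod_{j\ne i}\frac{\mu_i-q^{-2}\mu_j}{\mu_i-\mu_j},$$ understood as the polynomial in $\mu_1,\dots,\mu_m$ that is left after cancelling the denominators (so that coinciding $\mu_i$ are allowed), and let $$\mathcal O=\mathcal L(R)/\langle \operatorname{Tr}_R L-\alpha_1(\mu),\dots,\operatorname{Tr}_R L^m-\alpha_m(\mu)\rangle$$ (quotient by the two-sided ideal) be the braided orbit. Let $\Lambda_R$ be the vector space with basis the $N^2$ symbols $d\,l_i^j$, let $dL=(d\,l_i^j)$, and consider the right $\mathcal O$-module $$\Omega^1(\mathcal O)=(\Lambda_R\otimes\mathcal O)\big/\big\langle \operatorname{Tr}_R\big((dL)\,L^{k-1}\big),\ 1\le k\le m\big\rangle ,$$ the quotient of the free right module $\Lambda_R\otimes\mathcal O$ by the right submodule generated by the elements obtained by applying $d$ to the first factors of $\operatorname{Tr}_R L^k$. If $$\mu_i\ne q^2\mu_j\qquad\text{for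 all } 1\le i,j\le m,\ i\ne j,$$ then $\Omega^1(\mathcal O)$ is a projective right $\mathcal O$-module. -/

import Mathlib

noncomputable section

namespace Braided

open Matrix

/-- Matrices of operators on `V ⊗ V`, `dim V = N`. Rows carry the lower and columns the upper
indices: `R (i, b) (j, a)` is the entry `R_{ib}^{ja}`. -/
abbrev TwoMatrix (N : ℕ) : Type := Matrix (Fin N × Fin N) (Fin N × Fin N) ℂ

/-- The operator on `V^{⊗ k}` (with basis indexed by `Fin k → Fin N`) which acts as `R` on the
tensor factors `i`, `j` and as the identity on all the other ones. -/
def leg {N : ℕ} (R : TwoMatrix N) {k : ℕ} (i j : Fin k) :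
    Matrix (Fin k → Fin N) (Fin k → Fin N) ℂ :=
  Matrix.of fun x y =>
    if ∀ l, l ≠ i → l ≠ j → x l = y l then R (x i, x j) (y i, y j) else 0

/-- Hecke symmetry with parameter `q`, where `q` is generic (nonzero and not a root of unity). -/
structure IsHeckeSymmetry {N : ℕ} (R : TwoMatrix N) (q : ℂ) : Prop where
  q_ne_zero : q ≠ 0
  q_generic : ∀ k : ℕ, 0 < k → q ^ k ≠ 1
  braid : leg R (0 : Fin 3) 1 * leg R (1 : Fin 3) 2 * leg R (0 : Fin 3) 1 =
    leg R (1 : Fin 3) 2 * leg R (0 : Fin 3) 1 * leg R (1 : Fin 3) 2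
  hecke : (q • (1 : TwoMatrix N) - R) * (q⁻¹ • (1 : TwoMatrix N) + R) = 0

/-- `Tr_{(2)} R_{12} Ψ_{23} = P_{13}`. -/
def IsSkewInverse {N : ℕ} (R Ψ : TwoMatrix N) : Prop :=
  ∀ i j k n : Fin N, ∑ a, ∑ b, R (i, b) (j, a) * Ψ (a, k) (b, n) =
    if i = n ∧ k = j then 1 else 0

/-- The relations of degree `k` of the `R`-skew-symmetric algebra
`T(V) / ⟨Im (q⁻¹ I + R)⟩`: the sum of the images of `q⁻¹ I + R_i` in `V^{⊗ k}`. -/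
def skewRelations {N : ℕ} (R : TwoMatrix N) (q : ℂ) (k : ℕ) :
    Submodule ℂ ((Fin k → Fin N) → ℂ) :=
  ⨆ (i : ℕ) (h : i + 1 < k), LinearMap.range
    (Matrix.toLin' (q⁻¹ • (1 : Matrix (Fin k → Fin N) (Fin k → Fin N) ℂ) +
      leg R (⟨i, Nat.lt_of_succ_lt h⟩ : Fin k) ⟨i + 1, h⟩))

/-- The Hilbert-Poincare series `P_-(t)` of the `R`-skew-symmetric algebra. -/
def skewSeries {N : ℕ} (R : TwoMatrix N) (q : ℂ) : PowerSeries ℚ :=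
  PowerSeries.mk fun k =>
    (Module.finrank ℂ (((Fin k → Fin N) → ℂ) ⧸ skewRelations R q k) : ℚ)

/-- `R` has bi-rank `(m|n)`: the series `P_-(t)` is a rational function whose numerator and
denominator, in lowest terms, have degrees `m` and `n`. The symmetry is even if `n = 0`. -/
def HasBiRank {N : ℕ} (R : TwoMatrix N) (q : ℂ) (m n : ℕ) : Prop :=
  ∃ A B : Polynomial ℚ, IsCoprime A B ∧ A.natDegree = m ∧ B.natDegree = n ∧
    B.coeff 0 = 1 ∧ (B : PowerSeries ℚ) * skewSeries R q = (A : PowerSeries ℚ)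

/-- The matrix `C = Tr_{(2)} Ψ`. -/
def traceMatrix {N : ℕ} (Ψ : TwoMatrix N) : Matrix (Fin N) (Fin N) ℂ :=
  Matrix.of fun i j => ∑ k, Ψ (i, k) (j, k)

/-- The `R`-trace `Tr_R X = Tr (C X)`, for a matrix `X` with entries in a `ℂ`-module. -/
def rTrace {N : ℕ} (Ψ : TwoMatrix N) {A : Type*} [AddCommMonoid A] [Module ℂ A]
    (X : Matrix (Fin N) (Fin N) A) : A :=
  ∑ i, ∑ j, traceMatrix Ψ i j • X j i

/-! ### The reflection equation algebra -/

/-- The free generators `l_i^j`, as the entries of an `N × N` matrix. -/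
def freeL (N : ℕ) : Matrix (Fin N) (Fin N) (FreeAlgebra ℂ (Fin N × Fin N)) :=
  Matrix.of fun i j => FreeAlgebra.ι ℂ (i, j)

/-- `L ⊗ I`. -/
def freeL₁ (N : ℕ) :
    Matrix (Fin N × Fin N) (Fin N × Fin N) (FreeAlgebra ℂ (Fin N × Fin N)) :=
  Matrix.kroneckerMap (· * ·) (freeL N) 1

/-- `R` as a matrix with entries in the free algebra. -/
def freeR {N : ℕ} (R : TwoMatrix N) :
    Matrix (Fin N × Fin N) (Fin N × Fin N) (FreeAlgebra ℂ (Fin N × Fin N)) :=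
  R.map (algebraMap ℂ (FreeAlgebra ℂ (Fin N × Fin N)))

/-- The entries of the reflection equation `R L₁ R L₁ = L₁ R L₁ R`. -/
inductive RERel {N : ℕ} (R : TwoMatrix N) :
    FreeAlgebra ℂ (Fin N × Fin N) → FreeAlgebra ℂ (Fin N × Fin N) → Prop
  | entry (x y : Fin N × Fin N) :
      RERel R ((freeR R * freeL₁ N * freeR R * freeL₁ N) x y)
        ((freeL₁ N * freeR R * freeL₁ N * freeR R) x y)

/-- The reflection equation algebra `𝓛(R)`. -/
def REAlgebra {N : ℕ} (R : TwoMatrix N) : Type := RingQuot (RERel R)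

instance {N : ℕ} (R : TwoMatrix N) : Ring (REAlgebra R) :=
  inferInstanceAs (Ring (RingQuot (RERel R)))

instance {N : ℕ} (R : TwoMatrix N) : Algebra ℂ (REAlgebra R) :=
  inferInstanceAs (Algebra ℂ (RingQuot (RERel R)))

/-- The quotient map from the free algebra onto `𝓛(R)`. -/
def REAlgebra.mk {N : ℕ} (R : TwoMatrix N) :
    FreeAlgebra ℂ (Fin N × Fin N) →ₐ[ℂ] REAlgebra R :=
  RingQuot.mkAlgHom ℂ (RERel R)

/-- The generating matrix `L` of `𝓛(R)`. -/
def genL {N : ℕ} (R : TwoMatrix N) : Matrix (Fin N) (Fin N) (REAlgebra R) :=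
  (freeL N).map (REAlgebra.mk R)

/-! ### The braided orbit -/

/-- The power sum `α_k(μ)`, `k ≥ 1`: the polynomial in `μ` to which the expression
`q⁻¹ ∑ᵢ μᵢ^k ∏_{j ≠ i} (μᵢ - q⁻² μⱼ) / (μᵢ - μⱼ)` reduces after cancelling the denominators
(see `alpha_eq`); here it is written as a sum over the monomials of degree `k`. -/
def alpha (q : ℂ) {m : ℕ} (μ : Fin m → ℂ) (k : ℕ) : ℂ :=
  q⁻¹ * ∑ a ∈ Finset.finsuppAntidiag (Finset.univ : Finset (Fin m)) k,
    (1 - (q ^ 2)⁻¹) ^ (a.support.card - 1) * ∏ i, μ i ^ a i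

theorem partialFractions (c : ℂ) {m : ℕ} (μ : Fin m → ℂ) (hμ : Function.Injective μ) (x : ℂ) :
    ∏ j, (1 - c * μ j * x) = ∏ j, (1 - μ j * x) +
      ∑ i, (1 - c) * μ i * (∏ j ∈ Finset.univ.erase i, (μ i - c * μ j) / (μ i - μ j)) * x *
        ∏ j ∈ Finset.univ.erase i, (1 - μ j * x) := by
  classical
  set D : Fin m → ℂ := fun i => ∏ j ∈ Finset.univ.erase i, (μ i - c * μ j) / (μ i - μ j)
  have key : (∏ j, (Polynomial.X - Polynomial.C (c * μ j)) : Polynomial ℂ) =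
      ∏ j, (Polynomial.X - Polynomial.C (μ j)) +
        ∑ i, Polynomial.C ((1 - c) * μ i * D i) *
          ∏ j ∈ Finset.univ.erase i, (Polynomial.X - Polynomial.C (μ j)) := by
    refine Polynomial.eq_of_degree_sub_lt_of_eval_index_eq (s := Finset.univ) (v := μ)
      hμ.injOn ?_ ?_
    · rw [sub_add_eq_sub_sub]
      rcases Nat.eq_zero_or_pos m with rfl | hm
      · simp
      refine lt_of_le_of_lt (Polynomial.degree_sub_le _ _) (max_lt ?_ ?_)
      · have h1 : (∏ j, (Polynomial.X - Polynomial.C (c * μ j)) : Polynomial ℂ).degree = m := by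
          rw [Polynomial.degree_prod, Finset.sum_congr rfl fun j _ =>
            Polynomial.degree_X_sub_C (c * μ j)]
          simp
        have h2 : (∏ j, (Polynomial.X - Polynomial.C (μ j)) : Polynomial ℂ).degree = m := by
          simp [Polynomial.degree_prod]
        have := Polynomial.degree_sub_lt_left (h1.trans h2.symm)
          (Polynomial.monic_prod_X_sub_C _ _).ne_zero
          (by rw [(Polynomial.monic_prod_X_sub_C _ _).leadingCoeff,
            (Polynomial.monic_prod_X_sub_C _ _).leadingCoeff])
        rw [h1] at this
        simpa using this
      · refine lt_of_le_of_lt (Polynomial.degree_sum_le _ _) ?_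
        rw [Finset.sup_lt_iff (by simp)]
        intro i _
        rw [← Polynomial.smul_eq_C_mul]
        refine lt_of_le_of_lt (Polynomial.degree_smul_le _ _) ?_
        rw [Polynomial.degree_prod]
        simp only [Polynomial.degree_X_sub_C, Finset.sum_const, Finset.card_erase_of_mem
          (Finset.mem_univ i), Finset.card_univ, Fintype.card_fin, nsmul_one]
        exact_mod_cast Nat.sub_lt hm one_pos
    · intro i _
      have hz : ∏ j, (μ i - μ j) = 0 := Finset.prod_eq_zero (Finset.mem_univ i) (sub_self _)
      have hne : ∏ j ∈ Finset.univ.erase i, (μ i - μ j) ≠ 0 := by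
        refine Finset.prod_ne_zero_iff.2 fun j hj => sub_ne_zero.2 fun h => ?_
        exact (Finset.ne_of_mem_erase hj) (hμ h).symm
      simp only [Polynomial.eval_prod, Polynomial.eval_sub, Polynomial.eval_X, Polynomial.eval_C,
        Polynomial.eval_add, Polynomial.eval_finsetSum, Polynomial.eval_mul, hz, zero_add]
      rw [Finset.sum_eq_single i, ← Finset.mul_prod_erase Finset.univ _ (Finset.mem_univ i)]
      · simp only [D, Finset.prod_div_distrib]
        field_simp
      · intro l _ hl
        rw [Finset.prod_eq_zero (Finset.mem_erase.2 ⟨hl.symm, Finset.mem_univ i⟩) (sub_self _),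
          mul_zero]
      · simp
  rcases eq_or_ne x 0 with rfl | hx
  · simp
  have h := congrArg (fun p => x ^ m * Polynomial.eval x⁻¹ p) key
  simp only [Polynomial.eval_prod, Polynomial.eval_sub, Polynomial.eval_X, Polynomial.eval_C,
    Polynomial.eval_add, Polynomial.eval_finsetSum, Polynomial.eval_mul] at h
  have hp : ∀ f : Fin m → ℂ, x ^ m * ∏ j, (x⁻¹ - f j) = ∏ j, (1 - f j * x) := by
    intro f
    have : x ^ m = ∏ _j : Fin m, x := by simp
    rw [this, ← Finset.prod_mul_distrib]
    exact Finset.prod_congr rfl fun j _ => by field_simp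
  have hq : ∀ i, x ^ m * ∏ j ∈ Finset.univ.erase i, (x⁻¹ - μ j) =
      x * ∏ j ∈ Finset.univ.erase i, (1 - μ j * x) := by
    intro i
    have : x ^ m = x * ∏ _j ∈ Finset.univ.erase i, x := by
      rw [Finset.mul_prod_erase Finset.univ (fun _ => x) (Finset.mem_univ i)]; simp
    rw [this, mul_assoc, ← Finset.prod_mul_distrib]
    congr 1
    exact Finset.prod_congr rfl fun j _ => by field_simp
  rw [mul_add, hp, hp, Finset.mul_sum] at h
  rw [h]
  congr 1
  refine Finset.sum_congr rfl fun i _ => ?_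
  rw [mul_left_comm, hq, ← mul_assoc]

/-- For pairwise distinct `μᵢ`, `α_k(μ)` is the rational expression that it is named after. -/
theorem alpha_eq {q : ℂ} (hq : q ^ 2 ≠ 1) {m : ℕ} (μ : Fin m → ℂ) (hμ : Function.Injective μ)
    {k : ℕ} (hk : 1 ≤ k) :
    alpha q μ k = q⁻¹ * ∑ i, μ i ^ k *
      ∏ j ∈ Finset.univ.erase i, (μ i - (q ^ 2)⁻¹ * μ j) / (μ i - μ j) := by
  classical
  obtain ⟨k, rfl⟩ : ∃ l, k = l + 1 := ⟨k - 1, by omega⟩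
  unfold alpha
  congr 1
  set c : ℂ := (q ^ 2)⁻¹
  have hc : 1 - c ≠ 0 := sub_ne_zero.2 fun h => hq (inv_eq_one.1 h.symm)
  have hpf := partialFractions c μ hμ
  generalize hD : (fun i => ∏ j ∈ Finset.univ.erase i, (μ i - c * μ j) / (μ i - μ j)) = D
  have hD' : ∀ i, ∏ j ∈ Finset.univ.erase i, (μ i - c * μ j) / (μ i - μ j) = D i :=
    fun i => congrFun hD i
  simp only [hD'] at hpf ⊢
  have hpoly : (∏ j, (1 - Polynomial.C (c * μ j) * Polynomial.X) : Polynomial ℂ) =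
      ∏ j, (1 - Polynomial.C (μ j) * Polynomial.X) +
        ∑ i, Polynomial.C ((1 - c) * μ i * D i) * Polynomial.X *
          ∏ j ∈ Finset.univ.erase i, (1 - Polynomial.C (μ j) * Polynomial.X) := by
    refine Polynomial.funext fun x => ?_
    simpa [Polynomial.eval_prod, Polynomial.eval_finsetSum] using hpf x
  let G : Fin m → PowerSeries ℂ := fun j => PowerSeries.mk fun n => μ j ^ n
  have hG : ∀ j, (1 - PowerSeries.C (μ j) * PowerSeries.X) * G j = 1 := by
    intro j
    ext n
    rw [sub_mul, one_mul, mul_assoc, map_sub, PowerSeries.coeff_C_mul]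
    cases n with
    | zero => simp [G]
    | succ n => rw [PowerSeries.coeff_succ_X_mul]; simp [G, pow_succ']
  have hcoe : ∀ (a : Fin m → ℂ) (s : Finset (Fin m)),
      Polynomial.coeToPowerSeries.ringHom
        (∏ j ∈ s, (1 - Polynomial.C (a j) * Polynomial.X) : Polynomial ℂ) =
        ∏ j ∈ s, (1 - PowerSeries.C (a j) * PowerSeries.X) := by
    intro a s
    rw [map_prod]
    exact Finset.prod_congr rfl fun j _ => by
      rw [map_sub, map_one, map_mul]; simp
  have hps : ∏ j, (1 - PowerSeries.C (c * μ j) * PowerSeries.X) =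
      ∏ j, (1 - PowerSeries.C (μ j) * PowerSeries.X) +
        ∑ i, PowerSeries.C ((1 - c) * μ i * D i) * PowerSeries.X *
          ∏ j ∈ Finset.univ.erase i, (1 - PowerSeries.C (μ j) * PowerSeries.X) := by
    have h := congrArg Polynomial.coeToPowerSeries.ringHom hpoly
    rw [map_add, hcoe (fun j => c * μ j), hcoe, map_sum] at h
    rw [h]
    congr 1
    refine Finset.sum_congr rfl fun i _ => ?_
    rw [map_mul, map_mul, hcoe]
    simp
  have hF : ∏ j, ((1 - PowerSeries.C (c * μ j) * PowerSeries.X) * G j) =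
      1 + ∑ i, PowerSeries.C ((1 - c) * μ i * D i) * PowerSeries.X * G i := by
    rw [Finset.prod_mul_distrib]
    rw [hps, add_mul, ← Finset.prod_mul_distrib, Finset.prod_congr rfl fun j _ => hG j,
      Finset.prod_const_one, Finset.sum_mul]
    congr 1
    refine Finset.sum_congr rfl fun i _ => ?_
    rw [← Finset.mul_prod_erase Finset.univ G (Finset.mem_univ i)]
    have : (∏ j ∈ Finset.univ.erase i, (1 - PowerSeries.C (μ j) * PowerSeries.X)) *
        ∏ j ∈ Finset.univ.erase i, G j = 1 := by
      rw [← Finset.prod_mul_distrib, Finset.prod_congr rfl fun j _ => hG j,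
        Finset.prod_const_one]
    linear_combination (PowerSeries.C ((1 - c) * μ i * D i) * PowerSeries.X * G i) * this
  have hco := congrArg (PowerSeries.coeff (k + 1)) hF
  rw [PowerSeries.coeff_prod] at hco
  have hfac : ∀ j n, PowerSeries.coeff n
      ((1 - PowerSeries.C (c * μ j) * PowerSeries.X) * G j) =
        (if n = 0 then 1 else 1 - c) * μ j ^ n := by
    intro j n
    rw [sub_mul, one_mul, mul_assoc, map_sub, PowerSeries.coeff_C_mul]
    cases n with
    | zero => simp [G]
    | succ n => rw [PowerSeries.coeff_succ_X_mul]; simp [G]; ring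
  simp only [hfac, map_add, map_sum, mul_assoc, PowerSeries.coeff_C_mul,
    PowerSeries.coeff_succ_X_mul, Finset.prod_mul_distrib] at hco
  rw [PowerSeries.coeff_one, if_neg (Nat.succ_ne_zero k), zero_add] at hco
  refine mul_left_cancel₀ hc ?_
  rw [Finset.mul_sum, Finset.mul_sum]
  refine Eq.trans (Finset.sum_congr rfl fun a ha => ?_)
    (hco.trans (Finset.sum_congr rfl fun i _ => ?_))
  · have hs : a.support.card ≠ 0 := by
      intro h0
      have : a = 0 := by simpa using h0
      subst this
      simp [Finset.mem_finsuppAntidiag] at ha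
    have : ∏ i, (if a i = 0 then (1 : ℂ) else 1 - c) = (1 - c) ^ a.support.card := by
      rw [Finset.prod_ite, Finset.prod_const_one, one_mul, Finset.prod_const]
      congr 2
      ext i
      simp
    rw [this, ← mul_assoc, ← pow_succ', Nat.sub_add_cancel (Nat.pos_of_ne_zero hs)]
  · simp only [G, PowerSeries.coeff_mk]
    ring

/-- The relations `Tr_R L^k = α_k(μ)`, `1 ≤ k ≤ m`, where `k = n + 1`. -/
inductive OrbitRel {N : ℕ} (R Ψ : TwoMatrix N) (q : ℂ) {m : ℕ} (μ : Fin m → ℂ) :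
    REAlgebra R → REAlgebra R → Prop
  | powerSum (n : Fin m) :
      OrbitRel R Ψ q μ (rTrace Ψ (genL R ^ ((n : ℕ) + 1)))
        (algebraMap ℂ (REAlgebra R) (alpha q μ ((n : ℕ) + 1)))

/-- The braided orbit `𝓞 = 𝓛(R) / ⟨Tr_R L^k - α_k(μ), 1 ≤ k ≤ m⟩`. -/
def Orbit {N : ℕ} (R Ψ : TwoMatrix N) (q : ℂ) {m : ℕ} (μ : Fin m → ℂ) : Type :=
  RingQuot (OrbitRel R Ψ q μ)

instance {N : ℕ} (R Ψ : TwoMatrix N) (q : ℂ) {m : ℕ} (μ : Fin m → ℂ) :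
    Ring (Orbit R Ψ q μ) :=
  inferInstanceAs (Ring (RingQuot (OrbitRel R Ψ q μ)))

instance {N : ℕ} (R Ψ : TwoMatrix N) (q : ℂ) {m : ℕ} (μ : Fin m → ℂ) :
    Algebra ℂ (Orbit R Ψ q μ) :=
  inferInstanceAs (Algebra ℂ (RingQuot (OrbitRel R Ψ q μ)))

/-- The quotient map from `𝓛(R)` onto the braided orbit. -/
def Orbit.mk {N : ℕ} (R Ψ : TwoMatrix N) (q : ℂ) {m : ℕ} (μ : Fin m → ℂ) :
    REAlgebra R →ₐ[ℂ] Orbit R Ψ q μ :=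
  RingQuot.mkAlgHom ℂ (OrbitRel R Ψ q μ)

/-- The matrix `L` over the braided orbit. -/
def orbitL {N : ℕ} (R Ψ : TwoMatrix N) (q : ℂ) {m : ℕ} (μ : Fin m → ℂ) :
    Matrix (Fin N) (Fin N) (Orbit R Ψ q μ) :=
  (genL R).map (Orbit.mk R Ψ q μ)

/-! ### One-forms -/

/-- `Λ_R ⊗ 𝓞`, the free right `𝓞`-module on the symbols `d l_i^j`: a family `f` stands for
`∑ d l_i^j ⊗ f (i, j)`. Right `𝓞`-modules are modules over the opposite ring. -/
abbrev FreeForms {N : ℕ} (R Ψ : TwoMatrix N) (q : ℂ) {m : ℕ} (μ : Fin m → ℂ) : Type :=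
  Fin N × Fin N → Orbit R Ψ q μ

/-- The product `dL · X` of the matrix `dL = (d l_i^j)` with a matrix `X` over `𝓞`; its entry
`(i, j)` is `∑ₐ d l_i^a ⊗ X_a^j`. -/
def dLMul {N : ℕ} (R Ψ : TwoMatrix N) (q : ℂ) {m : ℕ} (μ : Fin m → ℂ)
    (X : Matrix (Fin N) (Fin N) (Orbit R Ψ q μ)) :
    Matrix (Fin N) (Fin N) (FreeForms R Ψ q μ) :=
  Matrix.of fun i j => ∑ a, Pi.single (i, a) (X a j)

/-- `d Tr_R L^k = Tr_R (dL · L^{k-1})` (`d` is applied to the first factor), `k = n + 1`. -/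
def dPowerSum {N : ℕ} (R Ψ : TwoMatrix N) (q : ℂ) {m : ℕ} (μ : Fin m → ℂ) (n : ℕ) :
    FreeForms R Ψ q μ :=
  rTrace Ψ (dLMul R Ψ q μ (orbitL R Ψ q μ ^ n))

/-- The right `𝓞`-module `Ω¹(𝓞) = (Λ_R ⊗ 𝓞) / ⟨d Tr_R L, …, d Tr_R L^m⟩`. -/
abbrev OneForms {N : ℕ} (R Ψ : TwoMatrix N) (q : ℂ) {m : ℕ} (μ : Fin m → ℂ) : Type :=
  FreeForms R Ψ q μ ⧸ Submodule.span (Orbit R Ψ q μ)ᵐᵒᵖ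
    (Set.range fun n : Fin m => dPowerSum R Ψ q μ (n : ℕ))

end Braided

end

noncomputable section

namespace Braided

/-! The forms ω_n = Tr_R(dL L^n), 0 ≤ n < m, span a free direct summand of the free module of forms,
so the quotient is projective. The summand is detected by right-linear coordinates dual to the ω_n.
Replacing dL by a matrix X is right-linear (`pairing`) and sends ω_n to Tr_R(X L^n). For X = L^i
this is Tr_R L^(i+n), a scalar in 𝓞. If the Hankel matrix of these scalars is invertible, its
inverse combines the powers of L into the dual coordinates, and `projective_quotient_span`
concludes.

The scalars: Tr_R L^k = α_k(μ) holds for every k ≥ 1, not only for k ≤ m (`rTrace_pow`), and Tr_R 1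
= Tr C = q⁻¹(1 + q⁻² + ⋯ + q^(-2(m-1))) (`trace_traceMatrix`). Both rest on the vanishing of the
skew-symmetric algebra in degree m + 1. For the first, the matrices M_k = Tr_R(2,…,k+1)(L_1 ⋯
L_(k+1) A), A being the antisymmetrizer of k + 1 factors, obey the recursion `skewPower_succ`. With
the quantum Newton identities `sum_signedElem_mul_alpha` it gives M_k, up to a nonzero factor, as ∑
(-1)^j e_j(μ) L^(k+1-j) (`skewMatrix_eq`). Since M_m = 0, this is L times a Cayley–Hamilton
identity, and it determines the higher power sums. For the second, an operator on m + 1 factors that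
must vanish is traced over its last factor.

The determinant: for distinct nonzero μ_i the power sums are weighted sums of μ_i^k, so the Hankel
matrix is Vᵀ D V with V a Vandermonde matrix. The denominators of D cancel against (det V)², leaving
± q^(-m) ∏_{i ≠ j} (μ_i - q⁻² μ_j). By continuity this holds for all μ (`det_hankel`), and the
hypothesis says exactly that the product is not zero. -/

/-! ### Antisymmetrizers of Hecke algebras -/

/-- Generators of a Hecke algebra, with the eigenvalues `r` and `-r⁻¹`. -/
structure HeckeGenerators {A : Type*} [Ring A] [Algebra ℂ A] (r : ℂ) (σ : ℕ → A) : Prop where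
  ne_zero : r ≠ 0
  braid : ∀ i, σ i * σ (i + 1) * σ i = σ (i + 1) * σ i * σ (i + 1)
  comm : ∀ i j, i + 2 ≤ j → σ i * σ j = σ j * σ i
  quad : ∀ i, σ i * σ i = 1 + (r - r⁻¹) • σ i

section Hecke

variable {A : Type*} [Ring A] [Algebra ℂ A] {r : ℂ} {σ : ℕ → A}

/-- The sum of `r ^ j • σ_s σ_{s+1} ⋯ σ_{s+j-1}` over `j ≤ k`. -/
def cosetSum (r : ℂ) (σ : ℕ → A) : ℕ → ℕ → A
  | _, 0 => 1
  | s, k + 1 => 1 + r • (σ s * cosetSum r σ (s + 1) k)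

/-- The sum of `r ^ j • σ_{k-1} σ_{k-2} ⋯ σ_{k-j}` over `j ≤ k`. -/
def cosetSumDesc (r : ℂ) (σ : ℕ → A) : ℕ → A
  | 0 => 1
  | k + 1 => 1 + r • (σ k * cosetSumDesc r σ k)

/-- The (unnormalized) antisymmetrizer on the strands `s, …, s + k - 1`. -/
def antisym (r : ℂ) (σ : ℕ → A) : ℕ → ℕ → A
  | _, 0 => 1
  | s, k + 1 => antisym r σ (s + 1) k * cosetSum r σ s k

/-- `1 + r² + ⋯ + r^{2k}`. -/
def qNum (r : ℂ) : ℕ → ℂ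
  | 0 => 1
  | k + 1 => 1 + r ^ 2 * qNum r k

/-- The product of the `qNum r j`, `j < k`. -/
def qFact (r : ℂ) : ℕ → ℂ
  | 0 => 1
  | k + 1 => qFact r k * qNum r k

theorem qNum_mul (r : ℂ) (k : ℕ) : (1 - r ^ 2) * qNum r k = 1 - (r ^ 2) ^ (k + 1) := by
  induction k with
  | zero => simp [qNum]
  | succ k ih => rw [qNum, pow_succ' _ (k + 1)]; linear_combination r ^ 2 * ih

theorem commute_cosetSum {x : A} (s k : ℕ)
    (h : ∀ j, s ≤ j → j < s + k → Commute x (σ j)) : Commute x (cosetSum r σ s k) := by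
  induction k generalizing s with
  | zero => exact Commute.one_right x
  | succ k ih =>
    exact (Commute.one_right x).add_right
      (((h s le_rfl (by omega)).mul_right
        (ih (s + 1) fun j h1 h2 => h j (by omega) (by omega))).smul_right r)

theorem commute_cosetSumDesc {x : A} (k : ℕ)
    (h : ∀ j, j < k → Commute x (σ j)) : Commute x (cosetSumDesc r σ k) := by
  induction k with
  | zero => exact Commute.one_right x
  | succ k ih =>
    exact (Commute.one_right x).add_right
      (((h k (by omega)).mul_right (ih fun j h1 => h j (by omega))).smul_right r)

theorem commute_antisym {x : A} (s k : ℕ)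
    (h : ∀ j, s ≤ j → j + 1 < s + k → Commute x (σ j)) : Commute x (antisym r σ s k) := by
  induction k generalizing s with
  | zero => exact Commute.one_right x
  | succ k ih =>
    exact (ih (s + 1) fun j h1 h2 => h j (by omega) (by omega)).mul_right
      (commute_cosetSum s k fun j h1 h2 => h j h1 (by omega))

theorem mul_cosetSum_of_eigen {x : A} (s k : ℕ)
    (h : ∀ j, s ≤ j → j < s + k → x * σ j = r • x) :
    x * cosetSum r σ s k = qNum r k • x := by
  induction k generalizing s with
  | zero => simp [cosetSum, qNum]
  | succ k ih =>
    rw [cosetSum, mul_add, mul_one, mul_smul_comm, ← mul_assoc, h s le_rfl (by omega),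
      smul_mul_assoc, ih (s + 1) fun j h1 h2 => h j (by omega) (by omega), qNum]
    module

theorem mul_cosetSumDesc_of_eigen {x : A} (k : ℕ) (h : ∀ j, j < k → x * σ j = r • x) :
    x * cosetSumDesc r σ k = qNum r k • x := by
  induction k with
  | zero => simp [cosetSumDesc, qNum]
  | succ k ih =>
    rw [cosetSumDesc, mul_add, mul_one, mul_smul_comm, ← mul_assoc, h k (by omega),
      smul_mul_assoc, ih fun j h1 => h j (by omega), qNum]
    module

theorem mul_antisym_of_eigen {x : A} (s k : ℕ)
    (h : ∀ j, s ≤ j → j + 1 < s + k → x * σ j = r • x) :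
    x * antisym r σ s k = qFact r k • x := by
  induction k generalizing s with
  | zero => simp [antisym, qFact]
  | succ k ih =>
    rw [antisym, ← mul_assoc, ih (s + 1) fun j h1 h2 => h j (by omega) (by omega),
      smul_mul_assoc, mul_cosetSum_of_eigen s k fun j h1 h2 => h j h1 (by omega), qFact,
      smul_smul]

theorem cosetSum_mul_of_eigen {x : A} (s k : ℕ)
    (h : ∀ j, s ≤ j → j < s + k → σ j * x = r • x) :
    cosetSum r σ s k * x = qNum r k • x := by
  induction k generalizing s with
  | zero => simp [cosetSum, qNum]
  | succ k ih =>
    rw [cosetSum, add_mul, one_mul, smul_mul_assoc, mul_assoc,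
      ih (s + 1) fun j h1 h2 => h j (by omega) (by omega), mul_smul_comm,
      h s le_rfl (by omega), qNum]
    module

theorem antisym_mul_of_eigen {x : A} (s k : ℕ)
    (h : ∀ j, s ≤ j → j + 1 < s + k → σ j * x = r • x) :
    antisym r σ s k * x = qFact r k • x := by
  induction k generalizing s with
  | zero => simp [antisym, qFact]
  | succ k ih =>
    rw [antisym, mul_assoc, cosetSum_mul_of_eigen s k fun j h1 h2 => h j h1 (by omega),
      mul_smul_comm, ih (s + 1) fun j h1 h2 => h j (by omega) (by omega), qFact,
      smul_smul, mul_comm]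

namespace HeckeGenerators

variable (H : HeckeGenerators r σ)
include H

theorem one_add_mul_self (i : ℕ) : (1 + r • σ i) * σ i = r • (1 + r • σ i) := by
  have h : r * (r - r⁻¹) = r ^ 2 - 1 := by have := H.ne_zero; field_simp
  rw [add_mul, one_mul, smul_mul_assoc, H.quad, smul_add, smul_smul, h]
  module

/-- Reversing words preserves the relations. This carries eigenvector statements about right
multiplication over to left multiplication. -/
theorem op : HeckeGenerators r (fun i => MulOpposite.op (σ i)) where
  ne_zero := H.ne_zero
  braid i := by
    simp only [← MulOpposite.op_mul]
    rw [← mul_assoc, ← mul_assoc, H.braid]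
  comm i j h := by simp only [← MulOpposite.op_mul]; rw [H.comm i j h]
  quad i := by
    simp only [← MulOpposite.op_mul]
    rw [H.quad]; simp

theorem commute_of_le {i j : ℕ} (h : i + 2 ≤ j ∨ j + 2 ≤ i) : Commute (σ i) (σ j) :=
  h.elim (fun h => H.comm i j h) fun h => (H.comm j i h).symm

/-- Only σ_s is new. In (1 + r σ_s) + r² σ_s σ_{s+1} Z the first term absorbs it by the quadratic
relation. In the second, σ_s commutes with Z and the braid relation turns it into σ_{s+1} on the far
left, where `x` absorbs it. For the other generators the induction runs with `x * σ s` in place of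
`x`. -/
theorem eigen_cosetSum {x : A} (s k : ℕ)
    (hx : ∀ j, s + 1 ≤ j → j < s + k → x * σ j = r • x) :
    ∀ i, s ≤ i → i < s + k →
      x * cosetSum r σ s k * σ i = r • (x * cosetSum r σ s k) := by
  induction k generalizing s x with
  | zero => intro i h1 h2; omega
  | succ k ih =>
    intro i h1 h2
    rcases h1.eq_or_lt with rfl | h1
    · cases k with
      | zero =>
        simp only [cosetSum, mul_one]
        rw [mul_assoc, H.one_add_mul_self, mul_smul_comm]
      | succ k =>
        set Z := cosetSum r σ (s + 2) k
        have hc : Z * σ s = σ s * Z := (commute_cosetSum (s + 2) k fun j h1 h2 =>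
          H.commute_of_le (by omega)).symm
        have e : cosetSum r σ s (k + 2) =
            (1 + r • σ s) + (r ^ 2) • (σ s * σ (s + 1) * Z) := by
          simp only [cosetSum, Z, mul_add, mul_one, mul_smul_comm, mul_assoc]
          module
        have h3 : x * (σ s * σ (s + 1) * Z) * σ s = r • (x * (σ s * σ (s + 1) * Z)) := by
          calc x * (σ s * σ (s + 1) * Z) * σ s
              = x * (σ s * σ (s + 1)) * (Z * σ s) := by simp only [mul_assoc]
            _ = x * (σ s * σ (s + 1) * σ s) * Z := by rw [hc]; simp only [mul_assoc]
            _ = (x * σ (s + 1)) * (σ s * σ (s + 1) * Z) := by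
              rw [H.braid]; simp only [mul_assoc]
            _ = _ := by rw [hx _ (by omega) (by omega), smul_mul_assoc]
        rw [e, mul_add, add_mul, mul_assoc x, H.one_add_mul_self, mul_smul_comm, mul_smul_comm,
          smul_mul_assoc, h3]
        module
    · have h4 := ih (x := x * σ s) (s + 1) (fun j h3 h4 => by
        rw [mul_assoc, H.comm s j (by omega), ← mul_assoc, hx j (by omega) (by omega),
          smul_mul_assoc]) i h1 (by omega)
      rw [cosetSum, mul_add, mul_one, mul_smul_comm, ← mul_assoc, add_mul, smul_mul_assoc, h4,
        hx i h1 h2]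
      module

/-- The mirror image of `eigen_cosetSum`, in which the last strand is the new one. It serves to
compute the trace of C, where only the last factor is traced out. -/
theorem eigen_cosetSumDesc {x : A} (k : ℕ) (hx : ∀ j, j + 1 < k → x * σ j = r • x) :
    ∀ i, i < k → x * cosetSumDesc r σ k * σ i = r • (x * cosetSumDesc r σ k) := by
  induction k generalizing x with
  | zero => intro i h2; omega
  | succ k ih =>
    intro i h2
    rcases (Nat.lt_succ_iff.1 h2).eq_or_lt with rfl | h1
    · cases i with
      | zero =>
        simp only [cosetSumDesc, mul_one]
        rw [mul_assoc, H.one_add_mul_self, mul_smul_comm]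
      | succ k =>
        set Z := cosetSumDesc r σ k
        have hc : Z * σ (k + 1) = σ (k + 1) * Z := (commute_cosetSumDesc k fun j h1 =>
          H.commute_of_le (by omega)).symm
        have e : cosetSumDesc r σ (k + 2) =
            (1 + r • σ (k + 1)) + (r ^ 2) • (σ (k + 1) * σ k * Z) := by
          simp only [cosetSumDesc, Z, mul_add, mul_one, mul_smul_comm, mul_assoc]
          module
        have h3 : x * (σ (k + 1) * σ k * Z) * σ (k + 1) = r • (x * (σ (k + 1) * σ k * Z)) := by
          calc x * (σ (k + 1) * σ k * Z) * σ (k + 1)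
              = x * (σ (k + 1) * σ k) * (Z * σ (k + 1)) := by simp only [mul_assoc]
            _ = x * (σ (k + 1) * σ k * σ (k + 1)) * Z := by rw [hc]; simp only [mul_assoc]
            _ = (x * σ k) * (σ (k + 1) * σ k * Z) := by
              rw [← H.braid]; simp only [mul_assoc]
            _ = _ := by rw [hx _ (by omega), smul_mul_assoc]
        rw [e, mul_add, add_mul, mul_assoc x, H.one_add_mul_self, mul_smul_comm, mul_smul_comm,
          smul_mul_assoc, h3]
        module
    · have h4 := ih (x := x * σ k) (fun j h3 => by
        rw [mul_assoc, ← H.comm j k (by omega), ← mul_assoc, hx j (by omega),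
          smul_mul_assoc]) i h1
      rw [cosetSumDesc, mul_add, mul_one, mul_smul_comm, ← mul_assoc, add_mul, smul_mul_assoc,
        h4, hx i (by omega)]
      module

theorem antisym_mul (s k : ℕ) : ∀ i, s ≤ i → i + 1 < s + k →
    antisym r σ s k * σ i = r • antisym r σ s k := by
  induction k generalizing s with
  | zero => intro i h1 h2; omega
  | succ k ih =>
    intro i h1 h2
    exact H.eigen_cosetSum s k (fun j h3 h4 => ih (s + 1) j h3 (by omega)) i h1 (by omega)

/-- The recursive definition favours the right side. Let `b` be the reversed antisymmetrizer, an
eigenvector from the left. Absorbing either factor of the product of the two into the other gives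
`qFact` times `b` and `qFact` times the antisymmetrizer, so they coincide. -/
theorem mul_antisym {s k : ℕ} (hk : qFact r k ≠ 0) (i : ℕ) (h1 : s ≤ i) (h2 : i + 1 < s + k) :
    σ i * antisym r σ s k = r • antisym r σ s k := by
  set b : A := MulOpposite.unop (antisym r (fun i => MulOpposite.op (σ i)) s k) with hb
  have hbl : ∀ j, s ≤ j → j + 1 < s + k → σ j * b = r • b := fun j h3 h4 =>
    congrArg MulOpposite.unop (H.op.antisym_mul s k j h3 h4)
  have hab := antisym_mul_of_eigen (x := b) s k hbl
  have hab' : antisym r σ s k * b = qFact r k • antisym r σ s k :=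
    congrArg MulOpposite.unop (antisym_mul_of_eigen (r := r)
      (σ := fun i => MulOpposite.op (σ i)) (x := MulOpposite.op (antisym r σ s k)) s k
      fun j h3 h4 => congrArg MulOpposite.op (H.antisym_mul s k j h3 h4))
  rw [show antisym r σ s k = b from smul_right_injective A hk (hab'.symm.trans hab), hbl i h1 h2]

end HeckeGenerators

end Hecke

open Matrix

/-! ### Commuting systems of matrix units and partial traces -/

theorem sum_rotate {α β γ M : Type*} [Fintype α] [Fintype β] [Fintype γ] [AddCommMonoid M]
    (f : α → β → γ → M) : ∑ a, ∑ b, ∑ c, f a b c = ∑ c, ∑ a, ∑ b, f a b c :=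
  (Finset.sum_congr rfl fun _ _ => Finset.sum_comm).trans Finset.sum_comm

section Units

variable {K : Type*} [Fintype K] [DecidableEq K] {A : Type*} [Ring A] [Algebra ℂ A]

/-- The element of `A` with coefficients `S` with respect to the matrix units `U`. -/
def unitSum (U : K → K → A) (S : Matrix K K ℂ) : A := ∑ x, ∑ y, S x y • U x y

omit [DecidableEq K] in
theorem unitSum_mul_mul (U U' : K → K → A) (S S' : Matrix K K ℂ) (X : A) :
    unitSum U S * X * unitSum U' S' =
      ∑ x, ∑ y, ∑ z, ∑ w, (S x y * S' z w) • (U x y * X * U' z w) := by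
  rw [unitSum, Finset.sum_mul, Finset.sum_mul]
  refine Finset.sum_congr rfl fun x _ => ?_
  rw [Finset.sum_mul, Finset.sum_mul]
  refine Finset.sum_congr rfl fun y _ => ?_
  rw [unitSum, Finset.mul_sum]
  refine Finset.sum_congr rfl fun z _ => ?_
  rw [Finset.mul_sum]
  exact Finset.sum_congr rfl fun w _ => by rw [smul_mul_assoc, smul_mul_smul_comm]

/-- `U` is a system of matrix units in `A`. -/
structure IsUnits (U : K → K → A) : Prop where
  mul : ∀ a b c d, U a b * U c d = if b = c then U a d else 0
  sum : ∑ a, U a a = 1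

namespace IsUnits

variable {U : K → K → A} (hU : IsUnits U)
include hU

theorem unitSum_one : unitSum U 1 = 1 := by
  simp [unitSum, Matrix.one_apply, hU.sum]

theorem unitSum_mul (S S' : Matrix K K ℂ) :
    unitSum U (S * S') = unitSum U S * unitSum U S' := by
  rw [← mul_one (unitSum U S), unitSum_mul_mul]
  simp only [mul_one, hU.mul, smul_ite, smul_zero, Finset.sum_ite_irrel, Finset.sum_const_zero,
    Finset.sum_ite_eq, Finset.mem_univ, if_true]
  simp only [unitSum, Matrix.mul_apply, Finset.sum_smul]
  exact Finset.sum_congr rfl fun x _ => Finset.sum_comm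

/-- Sandwiching between matrix units reads off one coefficient, whence the injectivity below. -/
theorem sum_mul_unitSum_mul (S : Matrix K K ℂ) (x y : K) :
    ∑ z, U z x * unitSum U S * U y z = S x y • (1 : A) := by
  have h : ∀ z, U z x * unitSum U S * U y z = S x y • U z z := by
    intro z
    simp [unitSum, Finset.sum_mul, Finset.mul_sum, hU.mul]
  rw [Finset.sum_congr rfl fun z _ => h z, ← Finset.smul_sum, hU.sum]

theorem unitSum_injective [Nontrivial A] : Function.Injective (unitSum U) := by
  intro S S' h
  ext x y
  have h1 := hU.sum_mul_unitSum_mul S x y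
  rw [h, hU.sum_mul_unitSum_mul] at h1
  exact (smul_left_injective ℂ one_ne_zero h1).symm

end IsUnits

omit [DecidableEq K] in
theorem unitSum_commute {U : K → K → A} {X : A} (h : ∀ a b, Commute (U a b) X)
    (S : Matrix K K ℂ) : Commute (unitSum U S) X :=
  Commute.sum_left _ _ _ fun a _ => Commute.sum_left _ _ _ fun b _ => (h a b).smul_left _

end Units

section Tower

variable {N : ℕ} {A : Type*} [Ring A] [Algebra ℂ A]

/-- Matrix units on tensor factors numbered by the natural numbers. -/
structure UnitTower (E : ℕ → Fin N → Fin N → A) : Prop where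
  units : ∀ i, IsUnits (E i)
  comm : ∀ i j, i ≠ j → ∀ a b c d, Commute (E i a b) (E j c d)

/-- The matrix units on the tensor factors `i` and `i + 1`. -/
def pairUnits (E : ℕ → Fin N → Fin N → A) (i : ℕ) (x y : Fin N × Fin N) : A :=
  E i x.1 y.1 * E (i + 1) x.2 y.2

/-- The operator `S` on the tensor factors `i` and `i + 1`. -/
def twoLeg (E : ℕ → Fin N → Fin N → A) (S : TwoMatrix N) (i : ℕ) : A :=
  unitSum (pairUnits E i) S

/-- `X` acts trivially on the tensor factor `i`. -/
def TrivialOn (E : ℕ → Fin N → Fin N → A) (i : ℕ) (X : A) : Prop :=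
  ∀ a b, Commute (E i a b) X

/-- The partial trace of `X`, weighted by `C`, on the tensor factor `i`. -/
def partialTrace (C : Matrix (Fin N) (Fin N) ℂ) (E : ℕ → Fin N → Fin N → A) (i : ℕ) :
    A →ₗ[ℂ] A :=
  ∑ a, ∑ b, ∑ c, C b a • (LinearMap.mulLeft ℂ (E i c a) ∘ₗ LinearMap.mulRight ℂ (E i b c))

theorem partialTrace_apply (C : Matrix (Fin N) (Fin N) ℂ) (E : ℕ → Fin N → Fin N → A) (i : ℕ)
    (X : A) : partialTrace C E i X = ∑ a, ∑ b, ∑ c, C b a • (E i c a * X * E i b c) := by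
  simp [partialTrace, LinearMap.sum_apply, mul_assoc]

omit [Algebra ℂ A] in
theorem TrivialOn.mul {E : ℕ → Fin N → Fin N → A} {i : ℕ} {X Y : A} (hX : TrivialOn E i X)
    (hY : TrivialOn E i Y) : TrivialOn E i (X * Y) := fun a b => (hX a b).mul_right (hY a b)

omit [Algebra ℂ A] in
theorem TrivialOn.one {E : ℕ → Fin N → Fin N → A} {i : ℕ} : TrivialOn E i (1 : A) :=
  fun _ _ => Commute.one_right _

theorem partialTrace_mul {C : Matrix (Fin N) (Fin N) ℂ} {E : ℕ → Fin N → Fin N → A} {i : ℕ}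
    {X : A} (hX : TrivialOn E i X) (Y : A) :
    partialTrace C E i (X * Y) = X * partialTrace C E i Y := by
  simp only [partialTrace_apply, Finset.mul_sum, mul_smul_comm]
  refine Finset.sum_congr rfl fun a _ => Finset.sum_congr rfl fun b _ =>
    Finset.sum_congr rfl fun c _ => ?_
  rw [← mul_assoc (E i c a), (hX c a).eq]
  simp only [mul_assoc]

theorem partialTrace_mul' {C : Matrix (Fin N) (Fin N) ℂ} {E : ℕ → Fin N → Fin N → A} {i : ℕ}
    {X : A} (hX : TrivialOn E i X) (Y : A) :
    partialTrace C E i (Y * X) = partialTrace C E i Y * X := by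
  simp only [partialTrace_apply, Finset.sum_mul, smul_mul_assoc]
  refine Finset.sum_congr rfl fun a _ => Finset.sum_congr rfl fun b _ =>
    Finset.sum_congr rfl fun c _ => ?_
  rw [mul_assoc _ (E i b c), (hX b c).eq]
  simp only [mul_assoc]

namespace UnitTower

variable {E : ℕ → Fin N → Fin N → A} (hE : UnitTower E) {C : Matrix (Fin N) (Fin N) ℂ}
include hE

omit [Algebra ℂ A] in
theorem pair (i : ℕ) : IsUnits (pairUnits E i) where
  mul a b c d := by
    have h : pairUnits E i a b * pairUnits E i c d =
        (E i a.1 b.1 * E i c.1 d.1) * (E (i + 1) a.2 b.2 * E (i + 1) c.2 d.2) := by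
      simp only [pairUnits]
      rw [mul_assoc, ← mul_assoc (E (i + 1) a.2 b.2),
        ((hE.comm (i + 1) i (by omega)) a.2 b.2 c.1 d.1).eq]
      simp only [mul_assoc]
    rw [h, (hE.units i).mul, (hE.units (i + 1)).mul, ite_mul, zero_mul, mul_ite, mul_zero,
      ← ite_and, pairUnits]
    simp only [Prod.ext_iff]
  sum := by
    rw [Fintype.sum_prod_type]
    simp only [pairUnits, ← Finset.mul_sum, (hE.units (i + 1)).sum, mul_one, (hE.units i).sum]

theorem twoLeg_mul (S S' : TwoMatrix N) (i : ℕ) :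
    twoLeg E (S * S') i = twoLeg E S i * twoLeg E S' i := (hE.pair i).unitSum_mul S S'

theorem twoLeg_one (i : ℕ) : twoLeg E (1 : TwoMatrix N) i = 1 := (hE.pair i).unitSum_one

omit [Algebra ℂ A] in
theorem trivialOn_unit {i j : ℕ} (h : i ≠ j) (a b : Fin N) : TrivialOn E i (E j a b) :=
  fun _ _ => hE.comm i j h _ _ _ _

theorem trivialOn_twoLeg {i j : ℕ} (h1 : i ≠ j) (h2 : i ≠ j + 1) (S : TwoMatrix N) :
    TrivialOn E i (twoLeg E S j) := by
  intro a b
  refine (unitSum_commute (fun x y => ?_) S).symm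
  exact ((hE.comm i j h1 a b x.1 y.1).mul_right (hE.comm i (j + 1) h2 a b x.2 y.2)).symm

theorem commute_twoLeg {i j : ℕ} (h : i + 2 ≤ j) (S S' : TwoMatrix N) :
    Commute (twoLeg E S i) (twoLeg E S' j) := by
  refine unitSum_commute (fun x y => ?_) S
  exact (hE.trivialOn_twoLeg (by omega) (by omega) S' x.1 y.1).mul_left
    (hE.trivialOn_twoLeg (by omega) (by omega) S' x.2 y.2)

theorem trivialOn_partialTrace (i : ℕ) (X : A) : TrivialOn E i (partialTrace C E i X) := by
  intro p s
  have hm := (hE.units i).mul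
  simp only [Commute, SemiconjBy, partialTrace_apply, Finset.mul_sum, Finset.sum_mul,
    mul_smul_comm, smul_mul_assoc, ← mul_assoc, hm]
  refine Finset.sum_congr rfl fun a _ => Finset.sum_congr rfl fun b _ => ?_
  simp [mul_assoc, hm, ite_mul, mul_ite]

theorem partialTrace_unit (i : ℕ) (p s : Fin N) :
    partialTrace C E i (E i p s) = C s p • (1 : A) := by
  have hm := (hE.units i).mul
  simp [partialTrace_apply, hm, ite_mul, ← Finset.smul_sum, (hE.units i).sum]

theorem partialTrace_one (i : ℕ) : partialTrace C E i (1 : A) = C.trace • (1 : A) := by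
  rw [← (hE.units i).sum, map_sum]
  simp only [hE.partialTrace_unit, ← Finset.sum_smul, (hE.units i).sum]
  rfl

theorem partialTrace_pair {i : ℕ} (x y : Fin N × Fin N) :
    partialTrace C E (i + 1) (pairUnits E i x y) = C y.2 x.2 • E i x.1 y.1 := by
  rw [pairUnits, partialTrace_mul (hE.trivialOn_unit (by omega) _ _), hE.partialTrace_unit,
    mul_smul_comm, mul_one]

/-- Tracing the third factor out of Tr_(2) R_12 Ψ_23 = P_13 turns Ψ into C and the flip into the
identity. -/
theorem partialTrace_twoLeg {R Ψ : TwoMatrix N} (hΨ : IsSkewInverse R Ψ) (i : ℕ) :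
    partialTrace (traceMatrix Ψ) E (i + 1) (twoLeg E R i) = 1 := by
  have h : ∀ a c, ∑ b, ∑ d, R (a, b) (c, d) * traceMatrix Ψ d b = if a = c then 1 else 0 := by
    intro a c
    have h1 : ∀ n, ∑ d, ∑ b, R (a, b) (c, d) * Ψ (d, n) (b, n) =
        if a = n ∧ n = c then 1 else 0 := fun n => hΨ a c n n
    simp only [traceMatrix, Matrix.of_apply, Finset.mul_sum]
    rw [sum_rotate]
    rw [Finset.sum_congr rfl fun n _ => (Finset.sum_comm.trans (h1 n))]
    by_cases hac : a = c
    · subst hac; simp [eq_comm]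
    · rw [if_neg hac]
      exact Finset.sum_eq_zero fun n _ => if_neg fun ⟨h2, h3⟩ => hac (h2.trans h3)
  rw [twoLeg, unitSum, map_sum]
  simp only [map_sum, map_smul, hE.partialTrace_pair, Fintype.sum_prod_type]
  rw [← (hE.units i).sum]
  refine Finset.sum_congr rfl fun a _ => ?_
  rw [Finset.sum_comm]
  simp only [smul_smul, ← Finset.sum_smul, h]
  simp

end UnitTower

/-- The contraction of `P₁₂` and `P'₁₂` along the second factor, weighted by `C`. -/
def contraction (C : Matrix (Fin N) (Fin N) ℂ) (P P' : TwoMatrix N) (a c a' c' : Fin N) : ℂ :=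
  ∑ b, ∑ d, ∑ d', P (a, b) (c, d) * P' (a', d) (c', d') * C d' b

namespace UnitTower

variable {E : ℕ → Fin N → Fin N → A} (hE : UnitTower E) {C : Matrix (Fin N) (Fin N) ℂ}
include hE

theorem partialTrace_pair_mul_mul {i : ℕ} {X : A} (hX : TrivialOn E (i + 1) X)
    (x y z w : Fin N × Fin N) :
    partialTrace C E (i + 1) (pairUnits E i x y * X * pairUnits E i z w) =
      if y.2 = z.2 then C w.2 x.2 • (E i x.1 y.1 * X * E i z.1 w.1) else 0 := by
  have h : pairUnits E i x y * X * pairUnits E i z w =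
      (E i x.1 y.1 * X * E i z.1 w.1) * (E (i + 1) x.2 y.2 * E (i + 1) z.2 w.2) := by
    simp only [pairUnits]
    calc _ = E i x.1 y.1 * (E (i + 1) x.2 y.2 * (X * E i z.1 w.1)) * E (i + 1) z.2 w.2 := by
          simp only [mul_assoc]
      _ = E i x.1 y.1 * ((X * E i z.1 w.1) * E (i + 1) x.2 y.2) * E (i + 1) z.2 w.2 := by
          rw [(hX.mul (hE.trivialOn_unit (by omega) z.1 w.1) x.2 y.2).eq]
      _ = _ := by simp only [mul_assoc]
  rw [h, partialTrace_mul (((hE.trivialOn_unit (by omega) _ _).mul hX).mul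
    (hE.trivialOn_unit (by omega) _ _)), (hE.units (i + 1)).mul]
  split_ifs
  · rw [hE.partialTrace_unit, mul_smul_comm, mul_one]
  · rw [map_zero, mul_zero]

theorem partialTrace_twoLeg_mul_mul {i : ℕ} {X : A} (hX : TrivialOn E (i + 1) X)
    (P P' : TwoMatrix N) :
    partialTrace C E (i + 1) (twoLeg E P i * X * twoLeg E P' i) =
      ∑ a, ∑ c, ∑ a', ∑ c', contraction C P P' a c a' c' • (E i a c * X * E i a' c') := by
  rw [twoLeg, twoLeg, unitSum_mul_mul]
  simp only [map_sum, map_smul, hE.partialTrace_pair_mul_mul hX, Fintype.sum_prod_type,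
    smul_ite, smul_zero, Finset.sum_ite_irrel, Finset.sum_const_zero, Finset.sum_ite_eq,
    Finset.mem_univ, if_true]
  simp only [contraction, Finset.sum_smul, smul_smul]
  refine Finset.sum_congr rfl fun a _ => ?_
  rw [Finset.sum_comm]
  refine Finset.sum_congr rfl fun c _ => ?_
  rw [sum_rotate]
  refine Finset.sum_congr rfl fun a' _ => ?_
  rw [sum_rotate]

end UnitTower

end Tower

/-! ### Consequences of skew-invertibility for the matrix C. -/

section Numeric

variable {N : ℕ} {R Ψ : TwoMatrix N}

/-- After a reshuffling of indices the skew-inverse is an ordinary inverse of a finite square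
matrix, so a one-sided inverse is two-sided. -/
theorem IsSkewInverse.symm (h : IsSkewInverse R Ψ) (a b a' b' : Fin N) :
    ∑ i, ∑ j, Ψ (a, j) (b, i) * R (i, b') (j, a') = if b = b' ∧ a = a' then 1 else 0 := by
  set M₁ : Matrix (Fin N × Fin N) (Fin N × Fin N) ℂ :=
    Matrix.of fun x y => R (x.1, y.1) (x.2, y.2)
  set M₂ : Matrix (Fin N × Fin N) (Fin N × Fin N) ℂ :=
    Matrix.of fun x y => Ψ (x.2, y.2) (x.1, y.1)
  have h1 : M₁ * M₂ = 1 := by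
    ext ⟨i, j⟩ ⟨n, k⟩
    simp only [M₁, M₂, Matrix.mul_apply, Matrix.of_apply, Fintype.sum_prod_type,
      Matrix.one_apply, Prod.mk.injEq]
    rw [Finset.sum_comm, h i j k n]
    simp only [eq_comm]
  have h2 : (M₂ * M₁) (b, a) (b', a') = (1 : TwoMatrix N) (b, a) (b', a') := by
    rw [mul_eq_one_comm.1 h1]
  simpa only [M₁, M₂, Matrix.mul_apply, Matrix.of_apply, Fintype.sum_prod_type,
      Matrix.one_apply, Prod.mk.injEq] using h2

/-- A two-index array is recovered, by means of Ψ, from its contraction with R. -/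
theorem IsSkewInverse.invert (h : IsSkewInverse R Ψ) (G : Fin N → Fin N → ℂ) (a c : Fin N) :
    ∑ i, ∑ k, Ψ (c, k) (a, i) * (∑ b, ∑ d, R (i, b) (k, d) * G b d) = G a c := by
  simp only [Finset.mul_sum]
  rw [sum_rotate]
  have h2 : ∀ b, ∑ i, ∑ k, ∑ d, Ψ (c, k) (a, i) * (R (i, b) (k, d) * G b d) =
      ∑ d, (if a = b ∧ c = d then 1 else 0) * G b d := by
    intro b
    rw [sum_rotate]
    refine Finset.sum_congr rfl fun d _ => ?_
    rw [← h.symm c a d b]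
    simp only [Finset.sum_mul, mul_assoc]
  rw [Finset.sum_congr rfl fun b _ => h2 b]
  simp [ite_and]

/-- The contraction of `P` and `P'` is what it is for a flip. -/
def IsFlipLike (C : Matrix (Fin N) (Fin N) ℂ) (P P' : TwoMatrix N) : Prop :=
  ∀ a c a' c', contraction C P P' a c a' c' = if a = c' then C a' c else 0

/-- The contraction is recovered by `invert` from its contraction with R. The Kronecker deltas then
leave a partial trace of Ψ, which is C. -/
theorem isFlipLike_of_sum (hΨ : IsSkewInverse R Ψ) {P P' : TwoMatrix N}
    (h : ∀ i a j c', ∑ c, ∑ a', contraction (traceMatrix Ψ) P P' a c a' c' * R (i, c) (j, a') =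
      if i = j ∧ a = c' then 1 else 0) : IsFlipLike (traceMatrix Ψ) P P' := by
  intro a c a' c'
  have h1 := hΨ.invert (fun b d => contraction (traceMatrix Ψ) P P' a b d c') c a'
  rw [← h1]
  simp only [fun i b k d => mul_comm (R (i, b) (k, d)), h, ite_and]
  by_cases hac : a = c' <;> simp [hac, traceMatrix]

/-- Each flip-like property, inverted by Ψ, rewrites a contraction of C with S = R⁻¹ as a
contraction of Ψ with C. Hence (C ⊗ C) S and S (C ⊗ C) both take the form C Ψ C with the same index
pattern, and commutation with S implies commutation with R. -/
theorem kronecker_commute {C : Matrix (Fin N) (Fin N) ℂ} {S : TwoMatrix N} 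
    (hRS : R * S = 1) (hΨ : IsSkewInverse R Ψ)
    (h1 : IsFlipLike C R S) (h2 : IsFlipLike C S R) :
    kroneckerMap (· * ·) C C * R = R * kroneckerMap (· * ·) C C := by
  have e1 : ∀ l c j a, ∑ b, C b a * S (l, c) (j, b) = ∑ k, Ψ (c, k) (a, j) * C l k := by
    intro l c j a
    rw [← hΨ.invert (fun a c => ∑ b, C b a * S (l, c) (j, b)) a c, Finset.sum_comm]
    refine Finset.sum_congr rfl fun k _ => ?_
    have h3 : ∀ i, ∑ b, ∑ d, R (i, b) (k, d) * ∑ d', C d' b * S (l, d) (j, d') =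
        if i = j then C l k else 0 := by
      intro i
      rw [← h1 i k l j, contraction]
      simp only [Finset.mul_sum]
      exact Finset.sum_congr rfl fun b _ => Finset.sum_congr rfl fun d _ =>
        Finset.sum_congr rfl fun d' _ => by ring
    simp [h3]
  have e2 : ∀ b i k c, ∑ a, C b a * S (i, a) (k, c) = ∑ l, Ψ (b, i) (c, l) * C l k := by
    intro b i k c
    rw [← hΨ.invert (fun c b => ∑ a, C b a * S (i, a) (k, c)) c b]
    refine Finset.sum_congr rfl fun l _ => ?_
    have h3 : ∀ j, ∑ d, ∑ d', R (l, d) (j, d') * ∑ a, C d' a * S (i, a) (k, d) =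
        if i = j then C l k else 0 := by
      intro j
      rw [← h2 i k l j, contraction]
      simp only [Finset.mul_sum]
      rw [sum_rotate]
      exact Finset.sum_congr rfl fun b _ => Finset.sum_congr rfl fun d _ =>
        Finset.sum_congr rfl fun d' _ => by ring
    simp [h3]
  have key : kroneckerMap (· * ·) C C * S = S * kroneckerMap (· * ·) C C := by
    ext ⟨p, q⟩ ⟨k, c⟩
    simp only [Matrix.mul_apply, kroneckerMap_apply, Fintype.sum_prod_type]
    have l1 : ∀ i, ∑ a, C p i * C q a * S (i, a) (k, c) =
        ∑ l, C p i * Ψ (q, i) (c, l) * C l k := by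
      intro i
      simp only [mul_assoc, ← Finset.mul_sum, e2]
    have l2 : ∀ j, ∑ b, S (p, q) (j, b) * (C j k * C b c) =
        ∑ k', C p k' * Ψ (q, k') (c, j) * C j k := by
      intro j
      have := e1 p q j c
      calc _ = (∑ b, C b c * S (p, q) (j, b)) * C j k := by
            rw [Finset.sum_mul]; exact Finset.sum_congr rfl fun _ _ => by ring
        _ = _ := by
            rw [this, Finset.sum_mul]; exact Finset.sum_congr rfl fun _ _ => by ring
    rw [Finset.sum_congr rfl fun i _ => l1 i, Finset.sum_congr rfl fun j _ => l2 j,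
      Finset.sum_comm]
  have hSR : S * R = 1 := mul_eq_one_comm.1 hRS
  calc kroneckerMap (· * ·) C C * R = (R * S) * kroneckerMap (· * ·) C C * R := by
        rw [hRS, one_mul]
    _ = R * (kroneckerMap (· * ·) C C * S) * R := by rw [key]; simp only [mul_assoc]
    _ = _ := by rw [mul_assoc, mul_assoc, hSR, mul_one]

end Numeric

/-! ### Conjugation invariance and cyclicity of the weighted traces. -/

section Tower

variable {N : ℕ} {A : Type*} [Ring A] [Algebra ℂ A]

namespace UnitTower

variable {E : ℕ → Fin N → Fin N → A} (hE : UnitTower E) {C : Matrix (Fin N) (Fin N) ℂ}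
include hE

theorem unit_mul_twoLeg_mul_unit (R : TwoMatrix N) (i : ℕ) (a c a' c' : Fin N) :
    E (i + 1) a c * twoLeg E R i * E (i + 1) a' c' =
      ∑ k, ∑ l, R (k, c) (l, a') • pairUnits E i (k, a) (l, c') := by
  have hm := (hE.units (i + 1)).mul
  have h : ∀ x y, E (i + 1) a c * pairUnits E i x y * E (i + 1) a' c' =
      if c = x.2 then if y.2 = a' then pairUnits E i (x.1, a) (y.1, c') else 0 else 0 := by
    intro x y
    rw [pairUnits, ← mul_assoc, (hE.comm (i + 1) i (by omega) a c x.1 y.1).eq, mul_assoc,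
      mul_assoc, ← mul_assoc (E (i + 1) a c), hm]
    split_ifs with h1 h2
    · subst h2; rw [hm, if_pos rfl, pairUnits]
    · rw [hm, if_neg h2, mul_zero]
    · rw [zero_mul, mul_zero]
  simp only [twoLeg, unitSum, Finset.mul_sum, Finset.sum_mul, mul_smul_comm, smul_mul_assoc, h,
    Fintype.sum_prod_type, smul_ite, smul_zero, Finset.sum_ite_irrel, Finset.sum_const_zero,
    Finset.sum_ite_eq, Finset.sum_ite_eq', Finset.mem_univ, if_true]

/-- The flip-like property concerns Tr_R(2)(P X_1 P') for all X. It suffices to test it with X one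
leg of R, because skew-invertibility makes the components of R along its other leg determine
everything. -/
theorem isFlipLike [Nontrivial A] {R Ψ P P' : TwoMatrix N} (hΨ : IsSkewInverse R Ψ)
    (h : partialTrace (traceMatrix Ψ) E 2 (twoLeg E P 1 * twoLeg E R 0 * twoLeg E P' 1) = 1) :
    IsFlipLike (traceMatrix Ψ) P P' := by
  refine isFlipLike_of_sum hΨ ?_
  set S : TwoMatrix N := Matrix.of fun x y => ∑ c, ∑ a',
    contraction (traceMatrix Ψ) P P' x.2 c a' y.2 * R (x.1, c) (y.1, a')
  have h1 : unitSum (pairUnits E 0) S = unitSum (pairUnits E 0) 1 := by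
    rw [(hE.pair 0).unitSum_one, ← h, hE.partialTrace_twoLeg_mul_mul
      (hE.trivialOn_twoLeg (by omega) (by omega) R)]
    simp only [unitSum, Fintype.sum_prod_type, hE.unit_mul_twoLeg_mul_unit R 0, S,
      Matrix.of_apply, Finset.sum_smul, Finset.smul_sum, smul_smul]
    rw [Finset.sum_comm]
    refine Finset.sum_congr rfl fun a _ => ?_
    refine (sum_rotate _).trans (Eq.trans ?_ (sum_rotate _).symm)
    refine Finset.sum_congr rfl fun c' _ => ?_
    refine (sum_rotate _).trans (Finset.sum_congr rfl fun k _ => sum_rotate _)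
  intro i a j c'
  have h2 := congrFun (congrFun ((hE.pair 0).unitSum_injective h1) (i, a)) (j, c')
  simpa [S, Matrix.one_apply] using h2

/-- For P = R, P' = R⁻¹ this is the invariance Tr_R(2)(R X_1 R⁻¹) = Tr_R X. -/
theorem partialTrace_conj {P P' : TwoMatrix N} (h : IsFlipLike C P P') {i : ℕ} {X : A}
    (hX : TrivialOn E (i + 1) X) :
    partialTrace C E (i + 1) (twoLeg E P i * X * twoLeg E P' i) = partialTrace C E i X := by
  rw [hE.partialTrace_twoLeg_mul_mul hX, partialTrace_apply]
  simp only [h _ _ _ _, ite_smul, zero_smul, Finset.sum_ite_eq, Finset.mem_univ, if_true]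
  exact (sum_rotate _).symm

theorem partialTrace_eq (i : ℕ) (X : A) :
    partialTrace C E i X = partialTrace 1 E i (X * unitSum (E i) C) := by
  have hm := (hE.units i).mul
  have h : ∀ a c, unitSum (E i) C * E i a c = ∑ b, C b a • E i b c := by
    intro a c
    simp [unitSum, Finset.sum_mul, hm]
  simp only [partialTrace_apply, Matrix.one_apply, ite_smul, one_smul, zero_smul,
    ← mul_assoc]
  refine Finset.sum_congr rfl fun a _ => ?_
  rw [Finset.sum_comm]
  simp only [mul_assoc, h, Finset.mul_sum, mul_smul_comm, Finset.sum_ite_irrel,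
    Finset.sum_const_zero, Finset.sum_ite_eq', Finset.mem_univ, if_true]

theorem partialTrace_one_comm (i : ℕ) (X : A) (p s : Fin N) :
    partialTrace 1 E i (X * E i p s) = partialTrace 1 E i (E i p s * X) := by
  have hm := (hE.units i).mul
  simp only [partialTrace_apply, Matrix.one_apply, ite_smul, one_smul, zero_smul,
    mul_assoc, hm, mul_ite, mul_zero]
  simp only [← mul_assoc, hm, ite_mul, zero_mul]
  simp

theorem partialTrace_partialTrace_one_comm (i : ℕ) (X : A) (S : TwoMatrix N) :
    partialTrace 1 E i (partialTrace 1 E (i + 1) (X * twoLeg E S i)) =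
      partialTrace 1 E i (partialTrace 1 E (i + 1) (twoLeg E S i * X)) := by
  have h : ∀ x y, partialTrace 1 E i (partialTrace 1 E (i + 1) (X * pairUnits E i x y)) =
      partialTrace 1 E i (partialTrace 1 E (i + 1) (pairUnits E i x y * X)) := by
    intro x y
    have hc := (hE.comm i (i + 1) (by omega) x.1 y.1 x.2 y.2).eq
    have ht : TrivialOn E (i + 1) (E i x.1 y.1) := hE.trivialOn_unit (by omega) _ _
    rw [pairUnits, mul_assoc (E i x.1 y.1), partialTrace_mul ht, ← hE.partialTrace_one_comm i,
      ← hE.partialTrace_one_comm (i + 1), ← partialTrace_mul' ht, hc, mul_assoc X]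
  simp only [twoLeg, unitSum, Finset.mul_sum, Finset.sum_mul, mul_smul_comm, smul_mul_assoc,
    map_sum, map_smul, h]

/-- The two weights amount to multiplication by C ⊗ C inside unweighted traces, which are cyclic.
Commutation with C ⊗ C lets `S` pass the weight. -/
theorem partialTrace_partialTrace_comm {S : TwoMatrix N}
    (h : kroneckerMap (· * ·) C C * S = S * kroneckerMap (· * ·) C C) (i : ℕ) (X : A) :
    partialTrace C E i (partialTrace C E (i + 1) (X * twoLeg E S i)) =
      partialTrace C E i (partialTrace C E (i + 1) (twoLeg E S i * X)) := by
  have ht : TrivialOn E (i + 1) (unitSum (E i) C) := fun a b =>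
    (unitSum_commute (fun c d => hE.comm i (i + 1) (by omega) c d a b) C).symm
  have hk : unitSum (E (i + 1)) C * unitSum (E i) C =
      twoLeg E (kroneckerMap (· * ·) C C) i := by
    rw [(unitSum_commute (fun a b => (ht a b)) C).eq, ← mul_one (unitSum (E i) C),
      unitSum_mul_mul]
    simp only [mul_one, unitSum, twoLeg, pairUnits, kroneckerMap_apply, Fintype.sum_prod_type]
    exact Finset.sum_congr rfl fun a _ => Finset.sum_comm
  have h2 : ∀ X, partialTrace C E i (partialTrace C E (i + 1) X) = partialTrace 1 E i
      (partialTrace 1 E (i + 1) (X * twoLeg E (kroneckerMap (· * ·) C C) i)) := by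
    intro X
    rw [hE.partialTrace_eq i, hE.partialTrace_eq (i + 1), ← partialTrace_mul' ht, mul_assoc, hk]
  rw [h2, h2, mul_assoc, mul_assoc, ← hE.twoLeg_mul, ← h, hE.twoLeg_mul, ← mul_assoc,
    hE.partialTrace_partialTrace_one_comm]

end UnitTower

end Tower

/-! ### Copies of L on the tensor factors and the reflection equation. -/

section Reflection

variable {A : Type*} [Ring A] [Algebra ℂ A] {r : ℂ}

/-- The copies `L_{i+1} = σ_i L_i σ_i⁻¹` of a matrix `L₀`. -/
def copies (σ σ' : ℕ → A) (L₀ : A) : ℕ → A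
  | 0 => L₀
  | i + 1 => σ i * copies σ σ' L₀ i * σ' i

/-- The product `x_s x_{s+1} ⋯ x_{s+k-1}`. -/
def prodFrom (x : ℕ → A) : ℕ → ℕ → A
  | _, 0 => 1
  | s, k + 1 => x s * prodFrom x (s + 1) k

/-- The inverse of the product `σ_s σ_{s+1} ⋯ σ_{s+k-1}`, from the inverses of the `σ_i`. -/
def prodInv (x : ℕ → A) : ℕ → ℕ → A
  | _, 0 => 1
  | s, k + 1 => prodInv x (s + 1) k * x s

omit [Algebra ℂ A] in
theorem commute_prodFrom {x : ℕ → A} {y : A} (s k : ℕ)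
    (h : ∀ j, s ≤ j → j < s + k → Commute y (x j)) : Commute y (prodFrom x s k) := by
  induction k generalizing s with
  | zero => exact Commute.one_right y
  | succ k ih =>
    exact (h s le_rfl (by omega)).mul_right (ih (s + 1) fun j h1 h2 => h j (by omega) (by omega))

omit [Algebra ℂ A] in
theorem prodFrom_mul_prodInv {σ σ' : ℕ → A} (h : ∀ i, σ i * σ' i = 1) (s k : ℕ) :
    prodFrom σ s k * prodInv σ' s k = 1 := by
  induction k generalizing s with
  | zero => simp [prodFrom, prodInv]
  | succ k ih =>
    rw [prodFrom, prodInv, mul_assoc, ← mul_assoc (prodFrom σ (s + 1) k), ih, one_mul, h]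

/-- Generators of a Hecke algebra together with a solution of the reflection equation. -/
structure ReflectionData (r : ℂ) (σ σ' : ℕ → A) (L₀ : A) : Prop extends HeckeGenerators r σ where
  mul_inv : ∀ i, σ i * σ' i = 1
  inv_mul : ∀ i, σ' i * σ i = 1
  commute_zero : ∀ i, 1 ≤ i → Commute (σ i) L₀
  reflection : σ 0 * L₀ * σ 0 * L₀ = L₀ * σ 0 * L₀ * σ 0

namespace ReflectionData

variable {σ σ' : ℕ → A} {L₀ : A} (H : ReflectionData r σ σ' L₀)
include H

theorem commute_inv {i : ℕ} {x : A} (h : Commute (σ i) x) : Commute (σ' i) x :=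
  Commute.units_inv_left (u := ⟨σ i, σ' i, H.mul_inv i, H.inv_mul i⟩) h

theorem succ_mul (i : ℕ) : copies σ σ' L₀ (i + 1) * σ i = σ i * copies σ σ' L₀ i := by
  rw [copies, mul_assoc _ (σ' i), H.inv_mul, mul_one]

theorem commute_copies_of_lt {i j : ℕ} (h : i < j) : Commute (σ j) (copies σ σ' L₀ i) := by
  induction i with
  | zero => exact H.commute_zero j h
  | succ i ih =>
    have hc : Commute (σ i) (σ j) := H.commute_of_le (by omega)
    exact (hc.symm.mul_right (ih (by omega))).mul_right (H.commute_inv hc).symm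

/-- The essential case is i = j + 2. There σ_j, pushed through σ_{j+1} σ_j by the braid relation,
reaches L_j as σ_{j+1}, commutes with it, and is turned back into σ_j by the two inverses. -/
theorem commute_copies_of_le {i j : ℕ} (h : j + 2 ≤ i) : Commute (σ j) (copies σ σ' L₀ i) := by
  induction i with
  | zero => omega
  | succ i ih =>
    rcases (show j + 2 ≤ i ∨ i = j + 1 by omega) with h1 | rfl
    · have hc : Commute (σ i) (σ j) := H.commute_of_le (by omega)
      exact (hc.symm.mul_right (ih h1)).mul_right (H.commute_inv hc).symm
    · have hL : σ (j + 1) * copies σ σ' L₀ j = copies σ σ' L₀ j * σ (j + 1) :=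
        (H.commute_copies_of_lt (Nat.lt_succ_self j)).eq
      have hw : σ (j + 1) * (σ' j * σ' (j + 1)) = σ' j * σ' (j + 1) * σ j := by
        calc σ (j + 1) * (σ' j * σ' (j + 1))
            = σ' j * σ' (j + 1) * (σ (j + 1) * σ j * σ (j + 1)) * (σ' j * σ' (j + 1)) := by
              simp only [mul_assoc]
              rw [← mul_assoc (σ' (j + 1)) (σ (j + 1)), H.inv_mul, one_mul,
                ← mul_assoc (σ' j) (σ j), H.inv_mul, one_mul]
          _ = σ' j * σ' (j + 1) * σ j := by
              rw [← H.braid]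
              simp only [mul_assoc]
              rw [← mul_assoc (σ j) (σ' j), H.mul_inv, one_mul, H.mul_inv, mul_one]
      show σ j * (σ (j + 1) * (σ j * copies σ σ' L₀ j * σ' j) * σ' (j + 1)) =
        (σ (j + 1) * (σ j * copies σ σ' L₀ j * σ' j) * σ' (j + 1)) * σ j
      calc σ j * (σ (j + 1) * (σ j * copies σ σ' L₀ j * σ' j) * σ' (j + 1))
          = (σ j * σ (j + 1) * σ j) * copies σ σ' L₀ j * (σ' j * σ' (j + 1)) := by
            simp only [mul_assoc]
        _ = σ (j + 1) * σ j * (σ (j + 1) * copies σ σ' L₀ j) * (σ' j * σ' (j + 1)) := by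
            rw [H.braid]; simp only [mul_assoc]
        _ = σ (j + 1) * σ j * copies σ σ' L₀ j * (σ (j + 1) * (σ' j * σ' (j + 1))) := by
            rw [hL]; simp only [mul_assoc]
        _ = _ := by rw [hw]; simp only [mul_assoc]

/-- Conjugation by σ_s ⋯ σ_{s+k-1} moves everything by one strand. This is shown here for generators
and below for copies of L, their products, and antisymmetrizers. -/
theorem prodFrom_mul_generator (s k i : ℕ) (h1 : s ≤ i) (h2 : i + 1 < s + k) :
    prodFrom σ s k * σ i = σ (i + 1) * prodFrom σ s k := by
  induction k generalizing s with
  | zero => omega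
  | succ k ih =>
    rcases h1.eq_or_lt with rfl | h1
    · cases k with
      | zero => omega
      | succ k =>
        have hc : prodFrom σ (s + 2) k * σ s = σ s * prodFrom σ (s + 2) k :=
          (commute_prodFrom (s + 2) k fun j h1 h2 => H.commute_of_le (by omega)).symm
        simp only [prodFrom, mul_assoc]
        rw [hc, ← mul_assoc (σ (s + 1)), ← mul_assoc (σ s), ← mul_assoc (σ s), H.braid]
        simp only [mul_assoc]
    · rw [prodFrom, mul_assoc, ih (s + 1) h1 (by omega), ← mul_assoc,
        H.comm s (i + 1) (by omega), mul_assoc]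

theorem prodFrom_mul_copies (s k i : ℕ) (h1 : s ≤ i) (h2 : i < s + k) :
    prodFrom σ s k * copies σ σ' L₀ i = copies σ σ' L₀ (i + 1) * prodFrom σ s k := by
  induction k generalizing s with
  | zero => omega
  | succ k ih =>
    rcases h1.eq_or_lt with rfl | h1
    · have hc : prodFrom σ (s + 1) k * copies σ σ' L₀ s =
          copies σ σ' L₀ s * prodFrom σ (s + 1) k :=
        (commute_prodFrom (s + 1) k fun j h1 h2 => (H.commute_copies_of_lt h1).symm).symm
      rw [prodFrom, mul_assoc, hc, ← mul_assoc, ← mul_assoc, H.succ_mul]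
    · rw [prodFrom, mul_assoc, ih (s + 1) h1 (by omega), ← mul_assoc,
        (H.commute_copies_of_le (show s + 2 ≤ i + 1 by omega)).eq, mul_assoc]

/-- For i = 0 this is the reflection equation, and conjugation by σ_i σ_{i+1} shifts it one strand
further. -/
theorem commute_copies_mul_copies (i : ℕ) :
    Commute (σ i) (copies σ σ' L₀ i * copies σ σ' L₀ (i + 1)) := by
  induction i with
  | zero =>
    show σ 0 * (L₀ * (σ 0 * L₀ * σ' 0)) = L₀ * (σ 0 * L₀ * σ' 0) * σ 0
    calc _ = (σ 0 * L₀ * σ 0 * L₀) * σ' 0 := by simp only [mul_assoc]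
      _ = L₀ * σ 0 * L₀ * (σ 0 * σ' 0) := by rw [H.reflection]; simp only [mul_assoc]
      _ = L₀ * σ 0 * L₀ * (σ' 0 * σ 0) := by rw [H.mul_inv, H.inv_mul]
      _ = _ := by simp only [mul_assoc]
  | succ i ih =>
    have hw := H.prodFrom_mul_generator i 2 i le_rfl (by omega)
    have h1 := H.prodFrom_mul_copies i 2 i le_rfl (by omega)
    have h2 := H.prodFrom_mul_copies i 2 (i + 1) (by omega) (by omega)
    have hi := prodFrom_mul_prodInv H.mul_inv i 2
    set w := prodFrom σ i 2
    set v := prodInv σ' i 2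
    set X := copies σ σ' L₀ i * copies σ σ' L₀ (i + 1)
    set Y := copies σ σ' L₀ (i + 1) * copies σ σ' L₀ (i + 1 + 1)
    have h3 : w * X = Y * w := by
      simp only [X, Y]; rw [← mul_assoc, h1, mul_assoc, h2, mul_assoc]
    show σ (i + 1) * Y = Y * σ (i + 1)
    calc σ (i + 1) * Y = σ (i + 1) * (Y * w) * v := by
          rw [mul_assoc (σ (i + 1)) (Y * w) v, mul_assoc Y w v, hi, mul_one]
      _ = w * (σ i * X) * v := by rw [← h3, ← mul_assoc, ← hw]; simp only [mul_assoc]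
      _ = (w * X) * σ i * v := by rw [ih.eq]; simp only [mul_assoc]
      _ = Y * (w * σ i) * v := by rw [h3]; simp only [mul_assoc]
      _ = _ := by rw [hw, mul_assoc, mul_assoc _ w, hi, mul_one]

theorem commute_prodFrom_copies (s k j : ℕ) (h1 : s ≤ j) (h2 : j + 1 < s + k) :
    Commute (σ j) (prodFrom (copies σ σ' L₀) s k) := by
  induction k generalizing s with
  | zero => omega
  | succ k ih =>
    rcases h1.eq_or_lt with rfl | h1
    · cases k with
      | zero => omega
      | succ k =>
        rw [prodFrom, prodFrom, ← mul_assoc]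
        exact (H.commute_copies_mul_copies s).mul_right
          (commute_prodFrom _ _ fun i h1 h2 => H.commute_copies_of_le h1)
    · exact (H.commute_copies_of_lt h1).mul_right (ih (s + 1) h1 (by omega))

theorem prodFrom_mul_prodFrom_copies (n s k : ℕ) (h : s + k ≤ n) :
    prodFrom σ 0 n * prodFrom (copies σ σ' L₀) s k =
      prodFrom (copies σ σ' L₀) (s + 1) k * prodFrom σ 0 n := by
  induction k generalizing s with
  | zero => simp [prodFrom]
  | succ k ih =>
    rw [prodFrom, ← mul_assoc, H.prodFrom_mul_copies 0 n s (by omega) (by omega), mul_assoc,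
      ih (s + 1) (by omega), ← mul_assoc]
    rfl

theorem prodFrom_mul_cosetSum (n s k : ℕ) (h : s + k < n) :
    prodFrom σ 0 n * cosetSum r σ s k = cosetSum r σ (s + 1) k * prodFrom σ 0 n := by
  induction k generalizing s with
  | zero => simp [cosetSum]
  | succ k ih =>
    rw [cosetSum, cosetSum, mul_add, add_mul, mul_one, one_mul, mul_smul_comm, smul_mul_assoc,
      ← mul_assoc, H.prodFrom_mul_generator 0 n s (by omega) (by omega), mul_assoc,
      ih (s + 1) (by omega), ← mul_assoc]

theorem prodFrom_mul_antisym (n s k : ℕ) (h : s + k ≤ n) :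
    prodFrom σ 0 n * antisym r σ s k = antisym r σ (s + 1) k * prodFrom σ 0 n := by
  induction k generalizing s with
  | zero => simp [antisym]
  | succ k ih =>
    rw [antisym, antisym, ← mul_assoc, ih (s + 1) (by omega), mul_assoc,
      H.prodFrom_mul_cosetSum n s k (by omega), mul_assoc]

end ReflectionData

end Reflection

/-! ### Skew-symmetric powers of L and their recursion. -/

section Newton

variable {N : ℕ} {A : Type*} [Ring A] [Algebra ℂ A]

/-- The iterated partial trace on the tensor factors `s, …, s + k - 1`. -/
def iterTrace (C : Matrix (Fin N) (Fin N) ℂ) (E : ℕ → Fin N → Fin N → A) :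
    ℕ → ℕ → A →ₗ[ℂ] A
  | _, 0 => LinearMap.id
  | s, k + 1 => partialTrace C E s ∘ₗ iterTrace C E (s + 1) k

/-- A solution `L₀` of the reflection equation on the first tensor factor, and a braiding with
an invariant trace. -/
structure ReflectionTower (r : ℂ) (C : Matrix (Fin N) (Fin N) ℂ) (E : ℕ → Fin N → Fin N → A)
    (R S : TwoMatrix N) (L₀ : A) : Prop
    extends ReflectionData r (twoLeg E R) (twoLeg E S) L₀ where
  tower : UnitTower E
  flipLike : IsFlipLike C R S
  trace_twoLeg : ∀ i, partialTrace C E (i + 1) (twoLeg E R i) = 1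
  kronecker : kroneckerMap (· * ·) C C * R = R * kroneckerMap (· * ·) C C
  trivialOn_zero : ∀ i, 1 ≤ i → TrivialOn E i L₀
  qFact_ne_zero : ∀ k, qFact r k ≠ 0

theorem iterTrace_mul {C : Matrix (Fin N) (Fin N) ℂ} {E : ℕ → Fin N → Fin N → A} {s k : ℕ}
    {X : A} (hX : ∀ j, s ≤ j → TrivialOn E j X) (Y : A) :
    iterTrace C E s k (X * Y) = X * iterTrace C E s k Y := by
  induction k generalizing s with
  | zero => rfl
  | succ k ih =>
    rw [iterTrace, LinearMap.comp_apply, ih fun j hj => hX j (by omega),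
      partialTrace_mul (hX s le_rfl), LinearMap.comp_apply]

theorem iterTrace_mul' {C : Matrix (Fin N) (Fin N) ℂ} {E : ℕ → Fin N → Fin N → A} {s k : ℕ}
    {X : A} (hX : ∀ j, s ≤ j → TrivialOn E j X) (Y : A) :
    iterTrace C E s k (Y * X) = iterTrace C E s k Y * X := by
  induction k generalizing s with
  | zero => rfl
  | succ k ih =>
    rw [iterTrace, LinearMap.comp_apply, ih fun j hj => hX j (by omega),
      partialTrace_mul' (hX s le_rfl), LinearMap.comp_apply]

namespace ReflectionTower

variable {r : ℂ} {C : Matrix (Fin N) (Fin N) ℂ} {E : ℕ → Fin N → Fin N → A}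
  {R S : TwoMatrix N} {L₀ : A} (H : ReflectionTower r C E R S L₀)
include H

theorem trivialOn_generator {i j : ℕ} (h : j + 2 ≤ i) : TrivialOn E i (twoLeg E R j) :=
  H.tower.trivialOn_twoLeg (by omega) (by omega) R

theorem trivialOn_copies {i j : ℕ} (h : j < i) :
    TrivialOn E i (copies (twoLeg E R) (twoLeg E S) L₀ j) := by
  induction j with
  | zero => exact H.trivialOn_zero i h
  | succ j ih =>
    exact ((H.tower.trivialOn_twoLeg (by omega) (by omega) R).mul (ih (by omega))).mul
      (H.tower.trivialOn_twoLeg (by omega) (by omega) S)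

theorem iterTrace_comm (s k j : ℕ) (h1 : s ≤ j) (h2 : j + 1 < s + k) (X : A) :
    iterTrace C E s k (X * twoLeg E R j) = iterTrace C E s k (twoLeg E R j * X) := by
  induction k generalizing s with
  | zero => omega
  | succ k ih =>
    rcases h1.eq_or_lt with rfl | h1
    · cases k with
      | zero => omega
      | succ k =>
        simp only [iterTrace, LinearMap.comp_apply]
        rw [iterTrace_mul' fun j hj => H.trivialOn_generator hj,
          iterTrace_mul fun j hj => H.trivialOn_generator hj,
          H.tower.partialTrace_partialTrace_comm H.kronecker]
    · rw [iterTrace, LinearMap.comp_apply, LinearMap.comp_apply, ih (s + 1) h1 (by omega)]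

theorem trivialOn_iterTrace_of_succ {s k : ℕ} {X : A} (hX : TrivialOn E (s + k) X) :
    TrivialOn E s (iterTrace C E s k X) := by
  cases k with
  | zero => exact hX
  | succ k => exact H.tower.trivialOn_partialTrace _ _

/-- The shift of an operator by one strand has the same trace as the operator. The outermost σ_s is
not seen by the inner traces, and `partialTrace_conj` removes it. -/
theorem iterTrace_conj (s k : ℕ) {X : A} (hX : TrivialOn E (s + k) X) :
    iterTrace C E (s + 1) k (prodFrom (twoLeg E R) s k * X * prodInv (twoLeg E S) s k) =
      iterTrace C E s k X := by
  induction k generalizing s with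
  | zero => simp [iterTrace, prodFrom, prodInv]
  | succ k ih =>
    have h : prodFrom (twoLeg E R) s (k + 1) * X * prodInv (twoLeg E S) s (k + 1) =
        twoLeg E R s * (prodFrom (twoLeg E R) (s + 1) k * X * prodInv (twoLeg E S) (s + 1) k) *
          twoLeg E S s := by
      simp only [prodFrom, prodInv, mul_assoc]
    have hX' : TrivialOn E (s + 1 + k) X := by rwa [show s + 1 + k = s + (k + 1) by omega]
    rw [h, iterTrace, LinearMap.comp_apply,
      iterTrace_mul' fun j hj => H.tower.trivialOn_twoLeg (by omega) (by omega) S,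
      iterTrace_mul fun j hj => H.trivialOn_generator hj, ih (s + 1) hX',
      H.tower.partialTrace_conj H.flipLike (H.trivialOn_iterTrace_of_succ hX'),
      iterTrace, LinearMap.comp_apply]

theorem trivialOn_prodFrom_copies {s k i : ℕ} (h : s + k ≤ i) :
    TrivialOn E i (prodFrom (copies (twoLeg E R) (twoLeg E S) L₀) s k) := fun a b =>
  commute_prodFrom s k fun _ _ h2 => H.trivialOn_copies (by omega) a b

theorem trivialOn_antisym {s k i : ℕ} (h : s + k ≤ i) :
    TrivialOn E i (antisym r (twoLeg E R) s k) := fun a b =>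
  commute_antisym s k fun _ _ h2 => H.trivialOn_generator (by omega) a b

end ReflectionTower

/-- `Tr_{R(2,…,k+1)} (A L₀ L₁ ⋯ L_k)`, with the antisymmetrizer `A` on `k + 1` factors. -/
def skewPower (r : ℂ) (C : Matrix (Fin N) (Fin N) ℂ) (E : ℕ → Fin N → Fin N → A)
    (R S : TwoMatrix N) (L₀ : A) (k : ℕ) : A :=
  iterTrace C E 1 k (prodFrom (copies (twoLeg E R) (twoLeg E S) L₀) 0 (k + 1) *
    antisym r (twoLeg E R) 0 (k + 1))

theorem skewPower_zero (r : ℂ) (C : Matrix (Fin N) (Fin N) ℂ) (E : ℕ → Fin N → Fin N → A)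
    (R S : TwoMatrix N) (L₀ : A) : skewPower r C E R S L₀ 0 = L₀ := by
  simp [skewPower, iterTrace, prodFrom, antisym, cosetSum, copies]

namespace ReflectionTower

variable {r : ℂ} {C : Matrix (Fin N) (Fin N) ℂ} {E : ℕ → Fin N → Fin N → A}
  {R S : TwoMatrix N} {L₀ : A} (H : ReflectionTower r C E R S L₀)
include H

/-- Under the trace the generators of the coset sum can be moved cyclically to the left of `G`,
where each contributes a factor r. -/
theorem iterTrace_mul_cosetSum {n : ℕ} {G : A}
    (hG : ∀ j, 1 ≤ j → j + 1 < 1 + n → twoLeg E R j * G = r • G) (s k : ℕ) (hs : 1 ≤ s)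
    (hk : s + k ≤ n) (w : A) :
    iterTrace C E 1 n (G * w * cosetSum r (twoLeg E R) s k) =
      qNum r k • iterTrace C E 1 n (G * w) := by
  induction k generalizing s w with
  | zero => simp [cosetSum, qNum]
  | succ k ih =>
    have h := ih (s + 1) (by omega) (by omega) (w * twoLeg E R s)
    rw [← mul_assoc G, H.iterTrace_comm 1 n s hs (by omega) (G * w), ← mul_assoc,
      hG s hs (by omega), smul_mul_assoc, map_smul] at h
    rw [cosetSum, mul_add, mul_one, mul_smul_comm, map_add, map_smul, ← mul_assoc, h, qNum]
    module

/-- The antisymmetrizer is split along its first strand as A_{1,…,k+1} (1 + r σ_0 ⋯). In the first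
term the shifted block `Q` is traced out completely and gives Tr_R M_k. In the second the remaining
coset sum contributes `qNum r k`. Tracing `Q` over all factors from 2 on gives σ_0 M_k σ_0⁻¹, whose
inverse cancels against σ_0, and the last trace is Tr_R(2) R = 1. -/
theorem skewPower_succ (k : ℕ) :
    skewPower r C E R S L₀ (k + 1) = L₀ * (partialTrace C E 0 (skewPower r C E R S L₀ k) +
      (r * qNum r k) • skewPower r C E R S L₀ k) := by
  set σ := twoLeg E R
  set σ' := twoLeg E S
  set lc := copies σ σ' L₀
  set F := prodFrom lc 0 (k + 1) * antisym r σ 0 (k + 1) with hF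
  set Q := prodFrom lc 1 (k + 1) * antisym r σ 1 (k + 1) with hQ
  have hFk : skewPower r C E R S L₀ k = iterTrace C E 1 k F := rfl
  have hFt : TrivialOn E (k + 1) F :=
    (H.trivialOn_prodFrom_copies (by omega)).mul (H.trivialOn_antisym (by omega))
  have hQF : Q = prodFrom σ 0 (k + 1) * F * prodInv σ' 0 (k + 1) := by
    have h1 : prodFrom σ 0 (k + 1) * F = Q * prodFrom σ 0 (k + 1) := by
      rw [hF, ← mul_assoc, H.prodFrom_mul_prodFrom_copies _ _ _ (by omega), mul_assoc,
        H.prodFrom_mul_antisym _ _ _ (by omega), ← mul_assoc]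
    rw [h1, mul_assoc, prodFrom_mul_prodInv H.mul_inv, mul_one]
  have hT1 : iterTrace C E 1 (k + 1) Q = partialTrace C E 0 (skewPower r C E R S L₀ k) := by
    rw [hQF]
    exact H.iterTrace_conj 0 (k + 1) (by simpa using hFt)
  have hT2 : iterTrace C E 2 k Q = σ 0 * skewPower r C E R S L₀ k * σ' 0 := by
    have h : Q = σ 0 * (prodFrom σ 1 k * F * prodInv σ' 1 k) * σ' 0 := by
      rw [hQF]; simp only [prodFrom, prodInv, mul_assoc]
    rw [h, iterTrace_mul' fun j hj => H.tower.trivialOn_twoLeg (by omega) (by omega) S,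
      iterTrace_mul fun j hj => H.trivialOn_generator hj,
      H.iterTrace_conj 1 k (by rwa [add_comm])]
    rfl
  have hL : ∀ j, 1 ≤ j → TrivialOn E j L₀ := H.trivialOn_zero
  -- σ_j passes L₀ and the product of copies, then meets the antisymmetrizer from the left; this is
  -- why the left-handed `mul_antisym` is needed.
  have hLQ : ∀ j, 1 ≤ j → j + 1 < 1 + (k + 1) → σ j * (L₀ * Q) = r • (L₀ * Q) := by
    intro j h1 h2
    rw [← mul_assoc, (H.commute_zero j h1).eq, mul_assoc, hQ, ← mul_assoc (σ j),
      (H.commute_prodFrom_copies 1 (k + 1) j h1 h2).eq, mul_assoc _ (σ j),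
      H.mul_antisym (H.qFact_ne_zero _) j h1 h2, mul_smul_comm, mul_smul_comm]
  have hsplit : prodFrom lc 0 (k + 2) * antisym r σ 0 (k + 2) =
      L₀ * Q + r • (L₀ * Q * σ 0 * cosetSum r σ 1 k) := by
    show L₀ * prodFrom lc 1 (k + 1) * (antisym r σ 1 (k + 1) *
      (1 + r • (σ 0 * cosetSum r σ 1 k))) = _
    rw [mul_add, mul_one, mul_smul_comm, mul_add, mul_smul_comm, hQ]
    simp only [mul_assoc]
  have hMt : TrivialOn E 1 (skewPower r C E R S L₀ k) :=
    H.trivialOn_iterTrace_of_succ (by rwa [add_comm])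
  have hlast : iterTrace C E 1 (k + 1) (L₀ * Q * σ 0) = L₀ * skewPower r C E R S L₀ k := by
    rw [mul_assoc, iterTrace_mul hL, iterTrace, LinearMap.comp_apply,
      iterTrace_mul' fun j hj => H.trivialOn_generator hj, hT2, mul_assoc _ (σ' 0),
      H.inv_mul, mul_one, partialTrace_mul' hMt, H.trace_twoLeg, one_mul]
  rw [skewPower, hsplit, map_add, map_smul, iterTrace_mul hL, hT1,
    H.iterTrace_mul_cosetSum hLQ 1 k le_rfl (by omega), hlast, mul_add, mul_smul_comm, smul_smul]

end ReflectionTower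

/-- The last factor occurs only in 1 and in the leading σ_k of the descending sum, whose traces are
Tr C and 1. The rest of the sum is absorbed by the antisymmetrizer. -/
theorem partialTrace_antisym_mul_cosetSumDesc {r : ℂ} {C : Matrix (Fin N) (Fin N) ℂ}
    {E : ℕ → Fin N → Fin N → A} {R : TwoMatrix N} (hE : UnitTower E)
    (H : HeckeGenerators r (twoLeg E R))
    (h : ∀ i, partialTrace C E (i + 1) (twoLeg E R i) = 1) (k : ℕ) :
    partialTrace C E (k + 1)
      (antisym r (twoLeg E R) 0 (k + 1) * cosetSumDesc r (twoLeg E R) (k + 1)) =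
      (C.trace + r * qNum r k) • antisym r (twoLeg E R) 0 (k + 1) := by
  have ha : TrivialOn E (k + 1) (antisym r (twoLeg E R) 0 (k + 1)) := fun a b =>
    commute_antisym 0 (k + 1) fun j _ h2 => hE.trivialOn_twoLeg (by omega) (by omega) R a b
  have hW : TrivialOn E (k + 1) (cosetSumDesc r (twoLeg E R) k) := fun a b =>
    commute_cosetSumDesc k fun j h2 => hE.trivialOn_twoLeg (by omega) (by omega) R a b
  rw [cosetSumDesc, partialTrace_mul ha, map_add, map_smul, hE.partialTrace_one,
    partialTrace_mul' hW, h, one_mul, mul_add, mul_smul_comm, mul_smul_comm, mul_one,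
    mul_cosetSumDesc_of_eigen k fun j hj => H.antisym_mul 0 (k + 1) j (by omega) (by omega)]
  module

end Newton

/-! ### Operators on selected coordinates of a function space. -/

/-- A very well-behaved lens: `K` is a factor of `X`. -/
structure Lens (X K : Type*) where
  get : X → K
  put : K → X → X
  get_put : ∀ v x, get (put v x) = v
  put_get : ∀ x, put (get x) x = x
  put_put : ∀ v w x, put v (put w x) = put v x

namespace Lens

section Amp

variable {X K : Type*} [Fintype K] [DecidableEq K] (l : Lens X K) {B : Type*} [Ring B]
  [Algebra ℂ B]

/-- The operator on `B`-valued functions on `X` given by a matrix acting on the factor `K`. -/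
def ampLinear : Matrix K K B →ₗ[ℂ] Module.End ℂ (X → B) where
  toFun M :=
    { toFun := fun g x => ∑ v, M (l.get x) v * g (l.put v x)
      map_add' := fun g h => by
        ext x; simp [mul_add, Finset.sum_add_distrib]
      map_smul' := fun c g => by
        ext x; simp [Finset.smul_sum] }
  map_add' M M' := by
    ext g x; simp [add_mul, Finset.sum_add_distrib]
  map_smul' c M := by
    ext g x; simp [Finset.smul_sum]

/-- `Lens.ampLinear` as a homomorphism of algebras. -/
def amp : Matrix K K B →ₐ[ℂ] Module.End ℂ (X → B) :=
  AlgHom.ofLinearMap l.ampLinear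
    (by
      refine LinearMap.ext fun g => funext fun x => ?_
      simp [ampLinear, Matrix.one_apply, l.put_get])
    (fun M M' => by
      refine LinearMap.ext fun g => funext fun x => ?_
      simp only [ampLinear, LinearMap.coe_mk, AddHom.coe_mk, Module.End.mul_apply,
        Matrix.mul_apply, l.get_put, l.put_put, Finset.sum_mul, Finset.mul_sum, mul_assoc]
      exact Finset.sum_comm)

theorem amp_apply (M : Matrix K K B) (g : X → B) (x : X) :
    l.amp M g x = ∑ v, M (l.get x) v * g (l.put v x) := rfl

theorem amp_injective [Nonempty X] : Function.Injective (l.amp (B := B)) := by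
  intro M M' h
  ext u v
  obtain ⟨x⟩ := ‹Nonempty X›
  have h1 := congrFun (LinearMap.congr_fun h fun y => if l.get y = v then 1 else 0) (l.put u x)
  simpa [amp_apply, l.get_put, l.put_put] using h1

/-- The operators given by scalar matrices. -/
def ampC (B : Type*) [Ring B] [Algebra ℂ B] : Matrix K K ℂ →ₐ[ℂ] Module.End ℂ (X → B) :=
  l.amp.comp (Algebra.ofId ℂ B).mapMatrix

theorem ampC_eq (M : Matrix K K ℂ) : l.ampC B M = l.amp (M.map (algebraMap ℂ B)) := rfl

theorem ampC_apply (M : Matrix K K ℂ) (g : X → B) (x : X) :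
    l.ampC B M g x = ∑ v, M (l.get x) v • g (l.put v x) := by
  simp [ampC_eq, amp_apply, Algebra.smul_def]

theorem ampC_injective [Nonempty X] [Nontrivial B] : Function.Injective (l.ampC B) := by
  intro M M' h
  ext u v
  have h1 := congrFun (congrFun (l.amp_injective h) u) v
  exact FaithfulSMul.algebraMap_injective ℂ B h1

/-- One of the matrices is scalar: operators with entries in the noncommutative `B` on different
factors need not commute. -/
theorem commute_amp {K' : Type*} [Fintype K'] [DecidableEq K'] (l' : Lens X K')
    (h1 : ∀ v x, l.get (l'.put v x) = l.get x) (h2 : ∀ v x, l'.get (l.put v x) = l'.get x)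
    (h3 : ∀ v w x, l.put v (l'.put w x) = l'.put w (l.put v x))
    (M : Matrix K K ℂ) (M' : Matrix K' K' B) : Commute (l.ampC B M) (l'.amp M') := by
  refine LinearMap.ext fun g => funext fun x => ?_
  simp only [Module.End.mul_apply, amp_apply, ampC_apply, Finset.smul_sum, Finset.mul_sum, h1,
    h2, h3, mul_smul_comm]
  exact Finset.sum_comm

end Amp

variable {N : ℕ}

/-- The tensor factor `i`. -/
def single (N i : ℕ) : Lens (ℕ → Fin N) (Fin N) where
  get x := x i
  put v x := Function.update x i v
  get_put v x := by simp
  put_get x := by simp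
  put_put v w x := by simp

/-- The tensor factors `i` and `j`. -/
def pair (N : ℕ) {i j : ℕ} (h : i ≠ j) : Lens (ℕ → Fin N) (Fin N × Fin N) where
  get x := (x i, x j)
  put v x := Function.update (Function.update x i v.1) j v.2
  get_put v x := by simp [h]
  put_get x := by simp
  put_put v w x := by
    rw [Function.update_comm h, Function.update_idem, Function.update_comm h.symm,
      Function.update_idem]

/-- The tensor factors given by an injective map. -/
def tuple (N : ℕ) {k : ℕ} {f : Fin k → ℕ} (h : Function.Injective f) :
    Lens (ℕ → Fin N) (Fin k → Fin N) where
  get x := x ∘ f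
  put v x := Function.extend f v x
  get_put v x := funext fun a => h.extend_apply v x a
  put_get x := by
    ext n
    by_cases hn : ∃ a, f a = n
    · obtain ⟨a, rfl⟩ := hn
      rw [h.extend_apply]; rfl
    · rw [Function.extend_apply' _ _ _ hn]
  put_put v w x := by
    ext n
    by_cases hn : ∃ a, f a = n
    · obtain ⟨a, rfl⟩ := hn
      rw [h.extend_apply, h.extend_apply]
    · simp only [Function.extend_apply' _ _ _ hn]

end Lens

/-! ### The model with infinitely many tensor factors. -/

section Model

variable (N : ℕ) (B : Type*) [Ring B] [Algebra ℂ B]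

/-- The matrix units on the tensor factors of the space of `B`-valued functions on `ℕ → Fin N`. -/
def modelUnits (i : ℕ) (a b : Fin N) : Module.End ℂ ((ℕ → Fin N) → B) :=
  (Lens.single N i).ampC B (Matrix.single a b 1)

variable {N B}

theorem modelUnits_eq (i : ℕ) (a b : Fin N) :
    modelUnits N B i a b = (Lens.single N i).amp (Matrix.single a b 1) := by
  rw [modelUnits, Lens.ampC_eq, Matrix.map_single _ _ _ (algebraMap ℂ B), map_one]

theorem modelUnits_apply (i : ℕ) (a b : Fin N) (g : (ℕ → Fin N) → B) (x : ℕ → Fin N) :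
    modelUnits N B i a b g x = if x i = a then g (Function.update x i b) else 0 := by
  rw [modelUnits, Lens.ampC_apply]
  rw [Finset.sum_eq_single b]
  · simp [Matrix.single_apply, Lens.single, eq_comm]
  · intro c _ hc
    simp [hc.symm]
  · simp

theorem trivialOn_amp {i j : ℕ} (h : i ≠ j) (M : Matrix (Fin N) (Fin N) B) :
    TrivialOn (modelUnits N B) i ((Lens.single N j).amp M) := fun _ _ =>
  Lens.commute_amp _ _ (fun v x => Function.update_of_ne h v x)
    (fun v x => Function.update_of_ne h.symm v x) (fun _ _ _ => Function.update_comm h.symm _ _ _)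
    _ _

theorem modelTower : UnitTower (modelUnits N B) where
  units i :=
    { mul := fun a b c d => by
        rw [modelUnits, modelUnits, ← map_mul]
        split_ifs with h
        · subst h; simp [modelUnits]
        · rw [Matrix.single_mul_single_of_ne _ _ _ _ h, map_zero]
      sum := by
        simp only [modelUnits, ← map_sum]
        rw [← map_one ((Lens.single N i).ampC B)]
        congr 1
        ext u v
        simp [Matrix.sum_apply, Matrix.single_apply, Matrix.one_apply, ite_and] }
  comm i j h a b c d := by
    have := trivialOn_amp (B := B) h (Matrix.single c d 1) a b
    rwa [← modelUnits_eq] at this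

theorem twoLeg_model (S : TwoMatrix N) (i : ℕ) :
    twoLeg (modelUnits N B) S i = (Lens.pair N (Nat.ne_of_lt (Nat.lt_succ_self i))).ampC B S := by
  refine LinearMap.ext fun g => funext fun x => ?_
  simp only [twoLeg, unitSum, pairUnits, LinearMap.sum_apply, Finset.sum_apply,
    LinearMap.smul_apply, Pi.smul_apply, Module.End.mul_apply, modelUnits_apply,
    Lens.ampC_apply]
  rw [Finset.sum_eq_single (x i, x (i + 1))]
  · refine Finset.sum_congr rfl fun v _ => ?_
    simp [Lens.pair]
  · intro y _ hy
    refine Finset.sum_eq_zero fun v _ => ?_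
    split_ifs with h1 h2
    · refine absurd (Prod.ext ?_ ?_) hy
      · exact h1.symm
      · rw [← h2]; simp
    · rw [smul_zero]
    · rw [smul_zero]
  · simp

/-- This links the model with `leg`, so that the braid relation on three factors and the skew
relations on k factors can be used in it. -/
theorem ampC_tuple_leg (S : TwoMatrix N) {k : ℕ} {f : Fin k → ℕ} (hf : Function.Injective f)
    {a b : Fin k} (hab : f a ≠ f b) :
    (Lens.tuple N hf).ampC B (leg S a b) = (Lens.pair N hab).ampC B S := by
  refine LinearMap.ext fun g => funext fun x => ?_
  rw [Lens.ampC_apply, Lens.ampC_apply]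
  have hab' : a ≠ b := fun h => hab (h ▸ rfl)
  symm
  refine Fintype.sum_of_injective
    (fun w : Fin N × Fin N => Function.update (Function.update (x ∘ f) a w.1) b w.2) ?_ _ _ ?_ ?_
  · intro w w' h
    have h1 := congrFun h a
    have h2 := congrFun h b
    simp only [Function.update_self, Function.update_of_ne hab'] at h1 h2
    exact Prod.ext h1 h2
  · intro v hv
    have : ¬ ∀ l, l ≠ a → l ≠ b → (x ∘ f) l = v l := by
      intro h
      refine hv ⟨(v a, v b), funext fun l => ?_⟩
      by_cases hb : l = b
      · subst hb; simp
      · by_cases ha : l = a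
        · subst ha; simp [hb]
        · simp only [Function.update_of_ne hb, Function.update_of_ne ha, h l ha hb]
    simp only [leg, Lens.tuple, Matrix.of_apply, if_neg this, zero_smul]
  · intro w
    have h1 : ∀ l, l ≠ a → l ≠ b →
        x (f l) = Function.update (Function.update (x ∘ f) a w.1) b w.2 l := by
      intro l ha hb
      simp only [Function.update_of_ne hb, Function.update_of_ne ha, Function.comp_apply]
    simp only [leg, Lens.tuple, Lens.pair, Matrix.of_apply, Function.update_self,
      Function.update_of_ne hab', Function.comp_apply]
    rw [if_pos h1]
    congr 2
    funext n
    by_cases hn : ∃ l, f l = n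
    · obtain ⟨l, rfl⟩ := hn
      rw [hf.extend_apply]
      simp only [Function.update_apply, hf.eq_iff, Function.comp_apply]
    · rw [Function.extend_apply' _ _ _ hn, Function.update_of_ne fun h => hn ⟨b, h.symm⟩,
        Function.update_of_ne fun h => hn ⟨a, h.symm⟩]

theorem twoLeg_model_braid {R : TwoMatrix N}
    (h : leg R (0 : Fin 3) 1 * leg R (1 : Fin 3) 2 * leg R (0 : Fin 3) 1 =
      leg R (1 : Fin 3) 2 * leg R (0 : Fin 3) 1 * leg R (1 : Fin 3) 2) (i : ℕ) :
    twoLeg (modelUnits N B) R i * twoLeg (modelUnits N B) R (i + 1) *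
        twoLeg (modelUnits N B) R i =
      twoLeg (modelUnits N B) R (i + 1) * twoLeg (modelUnits N B) R i *
        twoLeg (modelUnits N B) R (i + 1) := by
  have hf : Function.Injective fun l : Fin 3 => i + (l : ℕ) := fun a b h =>
    Fin.ext (Nat.add_left_cancel h)
  have h1 : twoLeg (modelUnits N B) R i = (Lens.tuple N hf).ampC B (leg R (0 : Fin 3) 1) := by
    rw [twoLeg_model, ampC_tuple_leg R hf (a := 0) (b := 1) (by simp)]
  have h2 : twoLeg (modelUnits N B) R (i + 1) =
      (Lens.tuple N hf).ampC B (leg R (1 : Fin 3) 2) := by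
    rw [twoLeg_model, ampC_tuple_leg R hf (a := 1) (b := 2) (by simp)]
  rw [h1, h2, ← map_mul, ← map_mul, ← map_mul, ← map_mul, h]

theorem twoLeg_model_eq_tuple (R : TwoMatrix N) {k i : ℕ} (h : i + 1 < k) :
    twoLeg (modelUnits N B) R i = (Lens.tuple N (Fin.val_injective (n := k))).ampC B
      (leg R ⟨i, Nat.lt_of_succ_lt h⟩ ⟨i + 1, h⟩) := by
  rw [twoLeg_model, ampC_tuple_leg R Fin.val_injective (a := ⟨i, Nat.lt_of_succ_lt h⟩)
    (b := ⟨i + 1, h⟩) (by simp)]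

theorem amp_kronecker_one (L : Matrix (Fin N) (Fin N) B) :
    (Lens.pair N (zero_ne_one : (0 : ℕ) ≠ 1)).amp (kroneckerMap (· * ·) L 1) =
      (Lens.single N 0).amp L := by
  refine LinearMap.ext fun g => funext fun x => ?_
  have h : ∀ v, Function.update (Function.update x 0 v) 1 (x 1) = Function.update x 0 v :=
    fun v => Function.update_eq_self_iff.2 (by simp)
  simp [Lens.amp_apply, Fintype.sum_prod_type, Matrix.one_apply, Lens.pair, Lens.single, h]

theorem partialTrace_amp (C : Matrix (Fin N) (Fin N) ℂ) (X : Matrix (Fin N) (Fin N) B) :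
    partialTrace C (modelUnits N B) 0 ((Lens.single N 0).amp X) =
      (Lens.single N 0).amp (Matrix.scalar (Fin N) (∑ i, ∑ j, C i j • X j i)) := by
  have h : ∀ a b, ∑ c, Matrix.single c a (1 : B) * X * Matrix.single b c 1 =
      Matrix.scalar (Fin N) (X a b) := by
    intro a b
    ext u v
    simp [Matrix.sum_apply, Matrix.single_apply, Matrix.diagonal_apply, ite_and]
  rw [partialTrace_apply]
  simp only [modelUnits_eq, ← map_mul, ← map_smul, ← map_sum, ← Finset.smul_sum, h]
  rw [Finset.sum_comm]
  congr 1
  ext u v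
  simp [Matrix.sum_apply, Matrix.diagonal_apply]

/-- An operator which is an eigenvector for right multiplication by the braiding kills the
relations of the skew-symmetric algebra. -/
theorem eq_zero_of_skewRelations_eq_top {R : TwoMatrix N} {q : ℂ} {k : ℕ}
    (h : skewRelations R q k = ⊤) {x : Module.End ℂ ((ℕ → Fin N) → B)}
    (hx : ∀ j, j + 1 < k → x * twoLeg (modelUnits N B) R j = (-q⁻¹) • x) : x = 0 := by
  set l := Lens.tuple N (Fin.val_injective (n := k))
  -- The vectors v such that x annihilates every rank-one operator with image in the line of v. It
  -- contains all skew relations, and the identity is a sum of rank-one operators.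
  let P : Submodule ℂ ((Fin k → Fin N) → ℂ) :=
    { carrier := {v | ∀ w, x * l.ampC B (vecMulVec v w) = 0}
      add_mem' := fun {v v'} hv hv' w => by
        rw [add_vecMulVec, map_add, mul_add, hv, hv', add_zero]
      zero_mem' := fun w => by rw [zero_vecMulVec, map_zero, mul_zero]
      smul_mem' := fun c v hv w => by
        rw [smul_vecMulVec, map_smul, mul_smul_comm, hv, smul_zero] }
  have hP : P = ⊤ := by
    rw [← top_le_iff, ← h, skewRelations]
    refine iSup_le fun i => iSup_le fun hi => ?_
    rintro _ ⟨v, rfl⟩ w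
    rw [Matrix.toLin'_apply, ← mul_vecMulVec, map_mul, map_add, map_smul, map_one,
      ← twoLeg_model_eq_tuple, ← mul_assoc, mul_add, hx i hi, mul_smul_comm, mul_one,
      show q⁻¹ • x + (-q⁻¹) • x = 0 by module, zero_mul]
  have h1 : (1 : Matrix (Fin k → Fin N) (Fin k → Fin N) ℂ) =
      ∑ u, vecMulVec (Pi.single u 1) (Pi.single u 1) := by
    ext a b
    simp [Matrix.sum_apply, vecMulVec_apply, Matrix.one_apply, Pi.single_apply]
  rw [← mul_one x, ← map_one (l.ampC B), h1, map_sum, Finset.mul_sum]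
  exact Finset.sum_eq_zero fun u _ => (hP ▸ Submodule.mem_top : Pi.single u 1 ∈ P) _

/-- A nonzero functional p vanishing on the relations is a left eigenvector of every leg of R with
eigenvalue -q⁻¹. A rank-one operator with rows p is therefore multiplied by `qFact`, not killed, by
the antisymmetrizer. -/
theorem antisym_ne_zero {R : TwoMatrix N} {q : ℂ} {k : ℕ} [Nontrivial B]
    (h : skewRelations R q k ≠ ⊤) (hk : qFact (-q⁻¹) k ≠ 0) (hN : 0 < N) :
    antisym (-q⁻¹) (twoLeg (modelUnits N B) R) 0 k ≠ 0 := by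
  intro ha
  set l := Lens.tuple N (Fin.val_injective (n := k))
  obtain ⟨φ, hφ, hle⟩ := Submodule.exists_le_ker_of_lt_top _ h.lt_top
  set p : (Fin k → Fin N) → ℂ := fun u => φ (Pi.single u 1)
  have hp : ∀ v, p ⬝ᵥ v = φ v := by
    intro v
    conv_rhs => rw [← Finset.univ_sum_single v]
    rw [map_sum, dotProduct]
    refine Finset.sum_congr rfl fun u _ => ?_
    rw [show Pi.single u (v u) = v u • (Pi.single u 1 : (Fin k → Fin N) → ℂ) by
      rw [← Pi.single_smul, smul_eq_mul, mul_one], map_smul, smul_eq_mul, mul_comm]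
  have hpR : ∀ i (hi : i + 1 < k), p ᵥ* (q⁻¹ • (1 : Matrix (Fin k → Fin N) (Fin k → Fin N) ℂ) +
      leg R (⟨i, Nat.lt_of_succ_lt hi⟩ : Fin k) ⟨i + 1, hi⟩) = 0 := by
    intro i hi
    refine dotProduct_eq_zero _ fun v => ?_
    rw [← dotProduct_mulVec, hp]
    refine hle ?_
    refine Submodule.mem_iSup_of_mem i (Submodule.mem_iSup_of_mem hi ⟨v, ?_⟩)
    rw [Matrix.toLin'_apply]
  set x := l.ampC B (vecMulVec 1 p)
  have hx : ∀ j, 0 ≤ j → j + 1 < 0 + k → x * twoLeg (modelUnits N B) R j = (-q⁻¹) • x := by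
    intro j _ hj
    rw [zero_add] at hj
    have h1 : x * l.ampC B (q⁻¹ • 1 + leg R ⟨j, Nat.lt_of_succ_lt hj⟩ ⟨j + 1, hj⟩) = 0 := by
      rw [← map_mul, vecMulVec_mul, hpR j hj, vecMulVec_zero, map_zero]
    rw [map_add, map_smul, map_one, ← twoLeg_model_eq_tuple, mul_add, mul_smul_comm, mul_one,
      add_comm] at h1
    rw [eq_neg_of_add_eq_zero_left h1]
    module
  have h2 := mul_antisym_of_eigen 0 k hx
  rw [ha, mul_zero, eq_comm, smul_eq_zero, or_iff_right hk] at h2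
  have : Nonempty (ℕ → Fin N) := ⟨fun _ => ⟨0, hN⟩⟩
  have h3 : vecMulVec (1 : (Fin k → Fin N) → ℂ) p = 0 :=
    l.ampC_injective (B := B) (h2.trans (map_zero _).symm)
  have h4 : p = 0 := by
    ext u
    have := congrFun (congrFun h3 u) u
    simpa [vecMulVec_apply] using this
  refine hφ (LinearMap.ext fun v => ?_)
  rw [← hp, h4, zero_dotProduct, LinearMap.zero_apply]

end Model

/-! ### Power sums -/

section Alpha

variable {q : ℂ} {m : ℕ}

/-- The coefficients of `∏ j, (1 - μ j * X)`, the signed elementary symmetric functions. -/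
def signedElem (μ : Fin m → ℂ) (k : ℕ) : ℂ :=
  (∏ j, (1 - Polynomial.C (μ j) * Polynomial.X) : Polynomial ℂ).coeff k

theorem natDegree_one_sub_le (μ : Fin m → ℂ) :
    (∏ j, (1 - Polynomial.C (μ j) * Polynomial.X) : Polynomial ℂ).natDegree ≤ m := by
  refine (Polynomial.natDegree_prod_le _ _).trans ((Finset.sum_le_card_nsmul _ _ 1 ?_).trans
    (by simp))
  intro j _
  refine (Polynomial.natDegree_sub_le _ _).trans (max_le (by simp) ?_)
  exact (Polynomial.natDegree_C_mul_le _ _).trans Polynomial.natDegree_X_le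

theorem signedElem_zero (μ : Fin m → ℂ) : signedElem μ 0 = 1 := by
  simp [signedElem, Polynomial.coeff_zero_prod]

theorem signedElem_of_lt (μ : Fin m → ℂ) {k : ℕ} (hk : m < k) : signedElem μ k = 0 :=
  Polynomial.coeff_eq_zero_of_natDegree_lt ((natDegree_one_sub_le μ).trans_lt hk)

theorem signedElem_ne_zero (μ : Fin m → ℂ) (h : ∀ i, μ i ≠ 0) : signedElem μ m ≠ 0 := by
  have hd : ∀ j, (1 - Polynomial.C (μ j) * Polynomial.X : Polynomial ℂ).natDegree = 1 := by
    intro j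
    rw [← Polynomial.natDegree_neg, neg_sub, ← Polynomial.C_1]
    exact Polynomial.natDegree_linear (b := -1) (h j) |> fun h => by
      simpa [sub_eq_add_neg] using h
  have h0 : ∀ j, (1 - Polynomial.C (μ j) * Polynomial.X : Polynomial ℂ) ≠ 0 := fun j h => by
    have := hd j
    rw [h] at this
    simp at this
  have hdeg : (∏ j, (1 - Polynomial.C (μ j) * Polynomial.X) : Polynomial ℂ).natDegree = m := by
    rw [Polynomial.natDegree_prod _ _ fun j _ => h0 j, Finset.sum_congr rfl fun j _ => hd j]
    simp
  have := Polynomial.leadingCoeff_ne_zero.2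
    (Finset.prod_ne_zero_iff.2 fun j (_ : j ∈ Finset.univ) => h0 j)
  rwa [Polynomial.leadingCoeff, hdeg] at this

theorem sum_signedElem_mul_pow (μ : Fin m → ℂ) {l : Fin m} (h : μ l ≠ 0) :
    ∑ j ∈ Finset.range (m + 1), signedElem μ j * μ l ^ (m - j) = 0 := by
  have h1 : (∏ j, (1 - Polynomial.C (μ j) * Polynomial.X) : Polynomial ℂ).eval (μ l)⁻¹ = 0 := by
    rw [Polynomial.eval_prod]
    exact Finset.prod_eq_zero (Finset.mem_univ l) (by simp [h])
  rw [Polynomial.eval_eq_sum_range' (Nat.lt_succ_of_le (natDegree_one_sub_le μ))] at h1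
  have h2 := congrArg (fun z => μ l ^ m * z) h1
  simp only [Finset.mul_sum, mul_zero] at h2
  rw [← h2]
  refine Finset.sum_congr rfl fun j hj => ?_
  rw [pow_sub₀ _ h (Nat.lt_succ_iff.1 (Finset.mem_range.1 hj)), signedElem, inv_pow]
  ring

/-- Each factor is 1 + (1 - c) ∑_{n ≥ 1} μ_j^n X^n, so a monomial collects one factor 1 - c per
variable occurring in it. -/
theorem coeff_prod_geometric (c : ℂ) (μ : Fin m → ℂ) (k : ℕ) :
    PowerSeries.coeff k (∏ j, ((1 - PowerSeries.C (c * μ j) * PowerSeries.X) *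
      PowerSeries.mk fun n => μ j ^ n)) =
    ∑ a ∈ Finset.finsuppAntidiag (Finset.univ : Finset (Fin m)) k,
      (1 - c) ^ a.support.card * ∏ i, μ i ^ a i := by
  have hfac : ∀ j n, PowerSeries.coeff n
      ((1 - PowerSeries.C (c * μ j) * PowerSeries.X) * PowerSeries.mk fun n => μ j ^ n) =
        (if n = 0 then 1 else 1 - c) * μ j ^ n := by
    intro j n
    rw [sub_mul, one_mul, mul_assoc, map_sub, PowerSeries.coeff_C_mul]
    cases n with
    | zero => simp
    | succ n => rw [PowerSeries.coeff_succ_X_mul]; simp; ring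
  rw [PowerSeries.coeff_prod]
  refine Finset.sum_congr rfl fun a _ => ?_
  simp only [hfac, Finset.prod_mul_distrib]
  congr 1
  rw [Finset.prod_ite, Finset.prod_const_one, one_mul, Finset.prod_const]
  congr 2
  ext i
  simp

/-- Quantum Newton identities. With F = ∏ (1 - μ_j X) and c = q⁻², the series P = F(cX)/F(X) has the
coefficients (1 - c) q α_n for n ≥ 1. The identity compares coefficients in F P = F(cX), using (1 -
c) `qNum` = 1 - c^(k+1). -/
theorem sum_signedElem_mul_alpha (hq0 : q ≠ 0) (hq : q ^ 2 ≠ 1) (μ : Fin m → ℂ) (k : ℕ) :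
    ∑ j ∈ Finset.range (k + 1), signedElem μ j * alpha q μ (k + 1 - j) =
      -q⁻¹ * qNum (-q⁻¹) k * signedElem μ (k + 1) := by
  set c : ℂ := (q ^ 2)⁻¹ with hc
  have hc1 : 1 - c ≠ 0 := sub_ne_zero.2 fun h => hq (inv_eq_one.1 h.symm)
  set G : Fin m → PowerSeries ℂ := fun j => PowerSeries.mk fun n => μ j ^ n
  set F : PowerSeries ℂ := ∏ j, (1 - PowerSeries.C (μ j) * PowerSeries.X) with hF
  set P : PowerSeries ℂ := ∏ j, ((1 - PowerSeries.C (c * μ j) * PowerSeries.X) * G j) with hP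
  have hG : ∀ j, (1 - PowerSeries.C (μ j) * PowerSeries.X) * G j = 1 := by
    intro j
    ext n
    rw [sub_mul, one_mul, mul_assoc, map_sub, PowerSeries.coeff_C_mul]
    cases n with
    | zero => simp [G]
    | succ n => rw [PowerSeries.coeff_succ_X_mul]; simp [G, pow_succ']
  have hcoe : F = Polynomial.coeToPowerSeries.ringHom
        (∏ j, (1 - Polynomial.C (μ j) * Polynomial.X) : Polynomial ℂ) := by
    rw [map_prod]
    exact Finset.prod_congr rfl fun j _ => by
      rw [map_sub, map_one, map_mul]; simp
  have hFc : ∀ n, PowerSeries.coeff n F = signedElem μ n := by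
    intro n
    rw [hcoe]; exact Polynomial.coeff_coe _ _
  have hFP : F * P = PowerSeries.rescale c F := by
    rw [hF, hP, ← Finset.prod_mul_distrib, map_prod]
    refine Finset.prod_congr rfl fun j _ => ?_
    rw [mul_left_comm, hG, mul_one, map_sub, map_one, map_mul (PowerSeries.rescale c),
      PowerSeries.rescale_X]
    have : PowerSeries.rescale c (PowerSeries.C (μ j)) = PowerSeries.C (μ j) := by
      ext n; cases n <;> simp [PowerSeries.coeff_rescale, PowerSeries.coeff_C]
    rw [this, ← mul_assoc, ← map_mul, mul_comm c]
  have hP0 : PowerSeries.coeff 0 P = 1 := by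
    rw [hP, coeff_prod_geometric]; simp
  have hPk : ∀ n, 0 < n → PowerSeries.coeff n P = (1 - c) * (q * alpha q μ n) := by
    intro n hn
    rw [hP, coeff_prod_geometric, alpha, mul_inv_cancel_left₀ hq0, Finset.mul_sum]
    refine Finset.sum_congr rfl fun a ha => ?_
    have hs : a.support.card ≠ 0 := by
      intro h0
      have : a = 0 := by simpa using h0
      subst this
      simp only [Finset.mem_finsuppAntidiag] at ha
      simp at ha
      omega
    rw [← mul_assoc, ← pow_succ', Nat.sub_add_cancel (Nat.pos_of_ne_zero hs)]
  have h := congrArg (PowerSeries.coeff (k + 1)) hFP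
  rw [PowerSeries.coeff_rescale, hFc, PowerSeries.coeff_mul,
    Finset.Nat.sum_antidiagonal_eq_sum_range_succ fun i j =>
      PowerSeries.coeff i F * PowerSeries.coeff j P, Finset.sum_range_succ, Nat.sub_self, hP0,
    hFc, mul_one, Finset.sum_congr rfl fun j hj => show
      PowerSeries.coeff j F * PowerSeries.coeff (k + 1 - j) P =
        (1 - c) * q * (signedElem μ j * alpha q μ (k + 1 - j)) by
        rw [hFc, hPk _ (by have := Finset.mem_range.1 hj; omega)]; ring, ← Finset.mul_sum] at h
  have hn := qNum_mul (-q⁻¹) k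
  rw [show (-q⁻¹) ^ 2 = c by rw [neg_sq, inv_pow]] at hn
  refine mul_left_cancel₀ (mul_ne_zero hc1 hq0) ?_
  have e : (1 - c) * q * (-q⁻¹ * qNum (-q⁻¹) k * signedElem μ (k + 1)) =
      -((1 - c) * qNum (-q⁻¹) k) * signedElem μ (k + 1) := by
    field_simp
  rw [e, hn]
  linear_combination h

/-- The power sums `Tr_R L^k` of a braided orbit, including `Tr_R 1` for `k = 0`. -/
def powerSum (q : ℂ) (μ : Fin m → ℂ) (k : ℕ) : ℂ :=
  if k = 0 then q⁻¹ * qNum (-q⁻¹) (m - 1) else alpha q μ k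

/-- The case k = 0 is new. Summing the characteristic equations of the μ_i with the weights D_i
relates e_m ∑ D_i to the positive power sums, which the Newton identity evaluates. Dividing by e_m
requires all μ_i to be nonzero. -/
theorem powerSum_eq (hq0 : q ≠ 0) (hq : q ^ 2 ≠ 1) (μ : Fin m → ℂ)
    (hμ : Function.Injective μ) (h0 : ∀ i, μ i ≠ 0) (hm : 0 < m) (k : ℕ) :
    powerSum q μ k = q⁻¹ * ∑ i, μ i ^ k *
      ∏ j ∈ Finset.univ.erase i, (μ i - (q ^ 2)⁻¹ * μ j) / (μ i - μ j) := by
  rcases Nat.eq_zero_or_pos k with rfl | hk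
  swap
  · rw [powerSum, if_neg hk.ne', alpha_eq hq μ hμ hk]
  obtain ⟨n, rfl⟩ : ∃ n, m = n + 1 := ⟨m - 1, by omega⟩
  rw [powerSum, if_pos rfl, Nat.add_sub_cancel]
  have h1 := sum_signedElem_mul_alpha hq0 hq μ n
  rw [Finset.sum_congr rfl fun j hj => by
    rw [alpha_eq hq μ hμ (show 1 ≤ n + 1 - j by have := Finset.mem_range.1 hj; omega)]] at h1
  generalize hD : (fun i => ∏ j ∈ Finset.univ.erase i, (μ i - (q ^ 2)⁻¹ * μ j) / (μ i - μ j)) = D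
  have hD' : ∀ i, ∏ j ∈ Finset.univ.erase i, (μ i - (q ^ 2)⁻¹ * μ j) / (μ i - μ j) = D i :=
    fun i => congrFun hD i
  simp only [hD', pow_zero, one_mul] at h1 ⊢
  have h2 : ∑ i, D i * ∑ j ∈ Finset.range (n + 1 + 1), signedElem μ j * μ i ^ (n + 1 - j) = 0 :=
    Finset.sum_eq_zero fun i _ => by rw [sum_signedElem_mul_pow μ (h0 i), mul_zero]
  have h3 : ∑ j ∈ Finset.range (n + 1), signedElem μ j * (q⁻¹ * ∑ i, μ i ^ (n + 1 - j) * D i) +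
      signedElem μ (n + 1) * (q⁻¹ * ∑ i, D i) = 0 := by
    have : ∑ j ∈ Finset.range (n + 1 + 1),
        signedElem μ j * (q⁻¹ * ∑ i, μ i ^ (n + 1 - j) * D i) = 0 := by
      rw [← mul_zero q⁻¹, ← h2]
      simp only [Finset.mul_sum]
      rw [Finset.sum_comm]
      exact Finset.sum_congr rfl fun i _ => Finset.sum_congr rfl fun j _ => by ring
    rw [Finset.sum_range_succ] at this
    simpa using this
  rw [h1] at h3
  refine mul_left_cancel₀ (signedElem_ne_zero μ h0) ?_
  linear_combination -h3

/-- The Hankel matrix of the power sums. -/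
def hankel (q : ℂ) (μ : Fin m → ℂ) : Matrix (Fin m) (Fin m) ℂ :=
  Matrix.of fun i j => powerSum q μ (i + j)

/-- The Hankel matrix of a measure supported at the points μ_i factors as Vᵀ D V, and (det V)²
cancels the denominators of the weights up to sign. -/
theorem det_hankel_of_injective (hq0 : q ≠ 0) (hq : q ^ 2 ≠ 1) (μ : Fin m → ℂ)
    (hμ : Function.Injective μ) (h0 : ∀ i, μ i ≠ 0) (hm : 0 < m) :
    (hankel q μ).det = (∏ i : Fin m, ∏ _j ∈ Finset.Ioi i, (-1 : ℂ)) *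
      ((q⁻¹) ^ m * ∏ i, ∏ j ∈ Finset.univ.erase i, (μ i - (q ^ 2)⁻¹ * μ j)) := by
  set D : Fin m → ℂ := fun i =>
    ∏ j ∈ Finset.univ.erase i, (μ i - (q ^ 2)⁻¹ * μ j) / (μ i - μ j) with hD
  have h1 : hankel q μ = (vandermonde μ)ᵀ * diagonal (fun i => q⁻¹ * D i) * vandermonde μ := by
    ext i j
    rw [hankel, Matrix.of_apply, powerSum_eq hq0 hq μ hμ h0 hm, Matrix.mul_apply, Finset.mul_sum]
    refine Finset.sum_congr rfl fun l _ => ?_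
    rw [Matrix.mul_diagonal, transpose_apply, vandermonde_apply, vandermonde_apply, pow_add]
    ring
  have h2 := Finset.prod_prod_Ioi_mul_eq_prod_prod_off_diag fun i j : Fin m => μ j - μ i
  have h3 : (vandermonde μ).det * (vandermonde μ).det =
      (∏ i : Fin m, ∏ _j ∈ Finset.Ioi i, (-1 : ℂ)) *
        ∏ i, ∏ j ∈ Finset.univ.erase i, (μ i - μ j) := by
    simp only [Finset.compl_singleton] at h2
    rw [det_vandermonde, ← h2, ← Finset.prod_mul_distrib, ← Finset.prod_mul_distrib]
    refine Finset.prod_congr rfl fun i _ => ?_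
    rw [← Finset.prod_mul_distrib, ← Finset.prod_mul_distrib]
    exact Finset.prod_congr rfl fun j _ => by ring
  have hne : ∏ i, ∏ j ∈ Finset.univ.erase i, (μ i - μ j) ≠ 0 :=
    Finset.prod_ne_zero_iff.2 fun i _ => Finset.prod_ne_zero_iff.2 fun j hj =>
      sub_ne_zero.2 fun h => Finset.ne_of_mem_erase hj (hμ h).symm
  rw [h1, det_mul, det_mul, det_transpose, det_diagonal, mul_right_comm, h3,
    Finset.prod_mul_distrib, Finset.prod_const, Finset.card_univ, Fintype.card_fin, hD]
  simp only [Finset.prod_div_distrib]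
  field_simp

theorem continuous_alpha (q : ℂ) (k : ℕ) : Continuous fun μ : Fin m → ℂ => alpha q μ k := by
  unfold alpha
  fun_prop

theorem det_hankel (hq0 : q ≠ 0) (hq : q ^ 2 ≠ 1) (μ : Fin m → ℂ) (hm : 0 < m) :
    (hankel q μ).det = (∏ i : Fin m, ∏ _j ∈ Finset.Ioi i, (-1 : ℂ)) *
      ((q⁻¹) ^ m * ∏ i, ∏ j ∈ Finset.univ.erase i, (μ i - (q ^ 2)⁻¹ * μ j)) := by
  -- Different slopes i + 1 ≠ 0 separate the entries and make them nonzero for all but countably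
  -- many t. Both sides are continuous in t and so agree at t = 0.
  set ν : ℂ → Fin m → ℂ := fun t i => μ i + t * ((i : ℕ) + 1) with hν
  have hνc : Continuous ν := by fun_prop
  have hh : ∀ i j, Continuous fun μ : Fin m → ℂ => hankel q μ i j := by
    intro i j
    simp only [hankel, Matrix.of_apply, powerSum]
    split_ifs
    · exact continuous_const
    · exact continuous_alpha q _
  have hc1 : Continuous fun t => (hankel q (ν t)).det :=
    Continuous.matrix_det (continuous_matrix fun i j => (hh i j).comp hνc)
  have hc2 : Continuous fun t => (∏ i : Fin m, ∏ _j ∈ Finset.Ioi i, (-1 : ℂ)) *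
      ((q⁻¹) ^ m * ∏ i, ∏ j ∈ Finset.univ.erase i, (ν t i - (q ^ 2)⁻¹ * ν t j)) := by
    fun_prop
  set bad : Set ℂ := (⋃ i, {t | ν t i = 0}) ∪ ⋃ i, ⋃ j, ⋃ (_ : i ≠ j), {t | ν t i = ν t j}
  have hbad : bad.Countable := by
    refine Set.Countable.union (Set.countable_iUnion fun i => ?_)
      (Set.countable_iUnion fun i => Set.countable_iUnion fun j => Set.countable_iUnion fun h => ?_)
    · refine Set.Subsingleton.countable fun t ht s hs => ?_
      simp only [hν, Set.mem_ofPred_eq] at ht hs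
      have h1 : ((i : ℕ) : ℂ) + 1 ≠ 0 := Nat.cast_add_one_ne_zero _
      exact mul_right_cancel₀ h1 (by linear_combination ht - hs)
    · refine Set.Subsingleton.countable fun t ht s hs => ?_
      simp only [hν, Set.mem_ofPred_eq] at ht hs
      have h1 : ((i : ℕ) : ℂ) - (j : ℕ) ≠ 0 := sub_ne_zero.2 fun h1 =>
        h (Fin.ext (Nat.cast_injective h1))
      exact mul_right_cancel₀ h1 (by linear_combination ht - hs)
  have hd : Dense badᶜ := hbad.dense_compl ℝ
  have heq := Continuous.ext_on hd hc1 hc2 fun t ht => by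
    have h0 : ∀ i, ν t i ≠ 0 := fun i hi => ht (Or.inl (Set.mem_iUnion.2 ⟨i, hi⟩))
    have hinj : Function.Injective (ν t) := by
      intro i j hij
      by_contra h
      exact ht (Or.inr (Set.mem_iUnion.2 ⟨i, Set.mem_iUnion.2 ⟨j, Set.mem_iUnion.2 ⟨h, hij⟩⟩⟩))
    exact det_hankel_of_injective hq0 hq _ hinj h0 hm
  simpa [hν] using congrFun heq 0

theorem isUnit_det_hankel (hq0 : q ≠ 0) (hq : q ^ 2 ≠ 1) (μ : Fin m → ℂ) (hm : 0 < m)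
    (hμ : ∀ i j : Fin m, i ≠ j → μ i ≠ q ^ 2 * μ j) : IsUnit (hankel q μ).det := by
  rw [det_hankel hq0 hq μ hm, isUnit_iff_ne_zero]
  refine mul_ne_zero (Finset.prod_ne_zero_iff.2 fun i _ => Finset.prod_ne_zero_iff.2 fun j _ =>
    by norm_num) (mul_ne_zero (pow_ne_zero _ (inv_ne_zero hq0)) ?_)
  refine Finset.prod_ne_zero_iff.2 fun i _ => Finset.prod_ne_zero_iff.2 fun j hj => ?_
  refine sub_ne_zero.2 fun h => hμ j i (Finset.ne_of_mem_erase hj) ?_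
  rw [h, mul_inv_cancel_left₀ (pow_ne_zero 2 hq0)]

end Alpha

/-! ### Hecke symmetries -/

namespace IsHeckeSymmetry

variable {N : ℕ} {R : TwoMatrix N} {q : ℂ} (hR : IsHeckeSymmetry R q)
include hR

theorem sq_ne_one : q ^ 2 ≠ 1 := hR.q_generic 2 two_pos

theorem sq_eq : R * R = 1 + (q - q⁻¹) • R := by
  have h := hR.hecke
  rw [sub_mul, mul_add, mul_add, smul_mul_smul_comm, mul_inv_cancel₀ hR.q_ne_zero, mul_one,
    smul_mul_assoc, one_mul, mul_smul_comm, mul_one, one_smul] at h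
  have h2 : R * R = (1 + q • R) - q⁻¹ • R := by
    rw [← sub_eq_zero, ← neg_eq_zero, ← h]; abel
  rw [h2]; module

/-- `R - (q - q⁻¹)` is the inverse of a Hecke symmetry `R`. -/
theorem mul_inv : R * (R - (q - q⁻¹) • 1) = 1 := by
  rw [mul_sub, hR.sq_eq, mul_smul_comm, mul_one, add_sub_cancel_right]

theorem qNum_ne_zero (k : ℕ) : qNum (-q⁻¹) k ≠ 0 := by
  intro h
  have h1 := qNum_mul (-q⁻¹) k
  rw [h, mul_zero, neg_sq, ← pow_mul, inv_pow, eq_comm, sub_eq_zero, eq_comm, inv_eq_one] at h1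
  exact hR.q_generic _ (by omega) h1

theorem qFact_ne_zero (k : ℕ) : qFact (-q⁻¹) k ≠ 0 := by
  induction k with
  | zero => exact one_ne_zero
  | succ k ih => exact mul_ne_zero ih (hR.qNum_ne_zero k)

theorem heckeGenerators (B : Type*) [Ring B] [Algebra ℂ B] :
    HeckeGenerators (-q⁻¹) (twoLeg (modelUnits N B) R) where
  ne_zero := neg_ne_zero.2 (inv_ne_zero hR.q_ne_zero)
  braid := twoLeg_model_braid hR.braid
  comm i j h := modelTower.commute_twoLeg h R R
  quad i := by
    rw [← modelTower.twoLeg_mul, hR.sq_eq, twoLeg_model, twoLeg_model, map_add, map_smul,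
      map_one, inv_neg, inv_inv]
    congr 2
    ring

variable {Ψ : TwoMatrix N} (hΨ : IsSkewInverse R Ψ)
include hΨ

/-- The braid relation gives R_2 R_1 R_2⁻¹ = R_1⁻¹ R_2 R_1. Tracing over the third factor only
affects R_2, with trace 1, so the outer factors cancel as `isFlipLike` requires. The other order is
similar. -/
theorem isFlipLike_inv : IsFlipLike (traceMatrix Ψ) R (R - (q - q⁻¹) • 1) ∧
    IsFlipLike (traceMatrix Ψ) (R - (q - q⁻¹) • 1) R := by
  rcases Nat.eq_zero_or_pos N with rfl | hN
  · exact ⟨fun a => a.elim0, fun a => a.elim0⟩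
  set S := R - (q - q⁻¹) • (1 : TwoMatrix N)
  have : Nonempty (ℕ → Fin N) := ⟨fun _ => ⟨0, hN⟩⟩
  -- The assertion is numerical, so the model over ℂ suffices; comparison of coefficients needs a
  -- nontrivial algebra, and 𝓞 is not known to be one.
  have hE := modelTower (N := N) (B := ℂ)
  have hb := (hR.heckeGenerators ℂ).braid 0
  have ht : partialTrace (traceMatrix Ψ) (modelUnits N ℂ) 2 (twoLeg (modelUnits N ℂ) R 1) = 1 :=
    hE.partialTrace_twoLeg hΨ 1
  have hi : ∀ i, twoLeg (modelUnits N ℂ) R i * twoLeg (modelUnits N ℂ) S i = 1 := fun i => by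
    rw [← hE.twoLeg_mul, hR.mul_inv, hE.twoLeg_one]
  have hi' : ∀ i, twoLeg (modelUnits N ℂ) S i * twoLeg (modelUnits N ℂ) R i = 1 := fun i => by
    rw [← hE.twoLeg_mul, mul_eq_one_comm.1 hR.mul_inv, hE.twoLeg_one]
  have htR : TrivialOn (modelUnits N ℂ) 2 (twoLeg (modelUnits N ℂ) R 0) :=
    hE.trivialOn_twoLeg (by omega) (by omega) R
  have htS : TrivialOn (modelUnits N ℂ) 2 (twoLeg (modelUnits N ℂ) S 0) :=
    hE.trivialOn_twoLeg (by omega) (by omega) S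
  constructor
  · refine hE.isFlipLike hΨ ?_
    have h : twoLeg (modelUnits N ℂ) R 1 * twoLeg (modelUnits N ℂ) R 0 *
        twoLeg (modelUnits N ℂ) S 1 = twoLeg (modelUnits N ℂ) S 0 *
          twoLeg (modelUnits N ℂ) R 1 * twoLeg (modelUnits N ℂ) R 0 := by
      set a := twoLeg (modelUnits N ℂ) R 0
      set b := twoLeg (modelUnits N ℂ) R 1
      set a' := twoLeg (modelUnits N ℂ) S 0
      set b' := twoLeg (modelUnits N ℂ) S 1
      calc b * a * b' = (a' * a) * b * a * b' := by rw [hi' 0, one_mul]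
        _ = a' * (a * b * a) * b' := by simp only [mul_assoc]
        _ = a' * b * a * (b * b') := by rw [hb]; simp only [mul_assoc]
        _ = _ := by rw [hi 1, mul_one]
    rw [h, partialTrace_mul' htR, partialTrace_mul htS, ht, mul_one, hi']
  · refine hE.isFlipLike hΨ ?_
    have h : twoLeg (modelUnits N ℂ) S 1 * twoLeg (modelUnits N ℂ) R 0 *
        twoLeg (modelUnits N ℂ) R 1 = twoLeg (modelUnits N ℂ) R 0 *
          twoLeg (modelUnits N ℂ) R 1 * twoLeg (modelUnits N ℂ) S 0 := by
      set a := twoLeg (modelUnits N ℂ) R 0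
      set b := twoLeg (modelUnits N ℂ) R 1
      set a' := twoLeg (modelUnits N ℂ) S 0
      set b' := twoLeg (modelUnits N ℂ) S 1
      calc b' * a * b = b' * a * b * (a * a') := by rw [hi 0, mul_one]
        _ = b' * (a * b * a) * a' := by simp only [mul_assoc]
        _ = (b' * b) * a * b * a' := by rw [hb]; simp only [mul_assoc]
        _ = _ := by rw [hi' 1, one_mul]
    rw [h, partialTrace_mul' htS, partialTrace_mul htR, ht, mul_one, hi]

/-- A solution of the reflection equation with entries in an algebra `B` yields a reflection
tower. -/
theorem reflectionTower {B : Type*} [Ring B] [Algebra ℂ B] {L : Matrix (Fin N) (Fin N) B}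
    (hL : R.map (algebraMap ℂ B) * kroneckerMap (· * ·) L 1 * R.map (algebraMap ℂ B) *
        kroneckerMap (· * ·) L 1 =
      kroneckerMap (· * ·) L 1 * R.map (algebraMap ℂ B) * kroneckerMap (· * ·) L 1 *
        R.map (algebraMap ℂ B)) :
    ReflectionTower (-q⁻¹) (traceMatrix Ψ) (modelUnits N B) R (R - (q - q⁻¹) • 1)
      ((Lens.single N 0).amp L) where
  toHeckeGenerators := hR.heckeGenerators B
  mul_inv i := by rw [← modelTower.twoLeg_mul, hR.mul_inv, modelTower.twoLeg_one]
  inv_mul i := by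
    rw [← modelTower.twoLeg_mul, mul_eq_one_comm.1 hR.mul_inv, modelTower.twoLeg_one]
  commute_zero i hi := by
    refine unitSum_commute (fun x y => ?_) R
    have h1 := trivialOn_amp (B := B) (show i ≠ 0 by omega) L x.1 y.1
    exact h1.mul_left (trivialOn_amp (by omega) L x.2 y.2)
  reflection := by
    have h := congrArg (Lens.pair N (zero_ne_one : (0 : ℕ) ≠ 1)).amp hL
    simp only [map_mul, amp_kronecker_one] at h
    rw [twoLeg_model]
    exact h
  tower := modelTower
  flipLike := (hR.isFlipLike_inv hΨ).1
  trace_twoLeg := modelTower.partialTrace_twoLeg hΨ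
  kronecker := kronecker_commute hR.mul_inv hΨ (hR.isFlipLike_inv hΨ).1 (hR.isFlipLike_inv hΨ).2
  trivialOn_zero i hi := trivialOn_amp (by omega) L
  qFact_ne_zero := hR.qFact_ne_zero

/-- The product of the antisymmetrizer on m factors and the descending coset sum is an eigenvector
for all generators on m + 1 factors, hence zero. Its trace over the last factor is (Tr C - q⁻¹
`qNum`) times an antisymmetrizer that is not zero. -/
theorem trace_traceMatrix {m : ℕ} (hm : 0 < m) (h1 : skewRelations R q (m + 1) = ⊤)
    (h2 : skewRelations R q m ≠ ⊤) :
    (traceMatrix Ψ).trace = q⁻¹ * qNum (-q⁻¹) (m - 1) := by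
  obtain ⟨k, rfl⟩ : ∃ k, m = k + 1 := ⟨m - 1, by omega⟩
  have hN : 0 < N := by
    rcases Nat.eq_zero_or_pos N with rfl | hN
    · exact absurd (Subsingleton.elim _ _) h2
    · exact hN
  have H := hR.heckeGenerators (N := N) ℂ
  have h3 := partialTrace_antisym_mul_cosetSumDesc (C := traceMatrix Ψ) modelTower H
    (modelTower.partialTrace_twoLeg hΨ) k
  have h4 := H.eigen_cosetSumDesc (k + 1) fun j hj =>
    H.antisym_mul 0 (k + 1) j (by omega) (by omega)
  rw [eq_zero_of_skewRelations_eq_top h1 fun j hj => h4 j (by omega), map_zero, eq_comm,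
    smul_eq_zero,
    or_iff_left (antisym_ne_zero h2 (hR.qFact_ne_zero _) hN)] at h3
  rw [Nat.add_sub_cancel]
  linear_combination h3

end IsHeckeSymmetry

theorem HasBiRank.skewRelations {N : ℕ} {R : TwoMatrix N} {q : ℂ} {m : ℕ}
    (h : HasBiRank R q m 0) : skewRelations R q (m + 1) = ⊤ ∧
      (0 < m → Braided.skewRelations R q m ≠ ⊤) := by
  obtain ⟨A, B, -, hA, hB, hB0, hAB⟩ := h
  have hB1 : B = 1 := by
    rw [Polynomial.eq_C_of_natDegree_eq_zero hB, hB0, map_one]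
  rw [hB1, Polynomial.coe_one, one_mul] at hAB
  have hc : ∀ k, (Module.finrank ℂ (((Fin k → Fin N) → ℂ) ⧸ Braided.skewRelations R q k) : ℚ) =
      A.coeff k := by
    intro k
    rw [← Polynomial.coeff_coe, ← hAB, skewSeries, PowerSeries.coeff_mk]
  constructor
  · have h1 := hc (m + 1)
    rw [Polynomial.coeff_eq_zero_of_natDegree_lt (by omega), Nat.cast_eq_zero] at h1
    exact Submodule.Quotient.subsingleton_iff.1 (Module.finrank_zero_iff.1 h1)
  · intro hm htop
    have h1 := hc m
    rw [htop] at h1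
    have h2 : A.coeff m = 0 := by
      rw [← h1, Nat.cast_eq_zero]
      exact Module.finrank_zero_iff.2 (Submodule.Quotient.subsingleton_iff.2 rfl)
    -- A positive degree excludes A = 0, so the coefficient at the degree cannot vanish.
    rw [← hA] at h2 hm
    rw [Polynomial.coeff_natDegree, Polynomial.leadingCoeff_eq_zero] at h2
    simp [h2] at hm

/-! ### The Cayley–Hamilton identity and the power sums of L. -/

section CayleyHamilton

variable {N : ℕ} {B : Type*} [Ring B] [Algebra ℂ B]

theorem rTrace_sum {Ψ : TwoMatrix N} {ι : Type*} (s : Finset ι)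
    (X : ι → Matrix (Fin N) (Fin N) B) :
    rTrace Ψ (∑ i ∈ s, X i) = ∑ i ∈ s, rTrace Ψ (X i) := by
  simp only [rTrace, Matrix.sum_apply, Finset.smul_sum]
  exact (Finset.sum_congr rfl fun _ _ => Finset.sum_comm).trans Finset.sum_comm

theorem rTrace_smul {Ψ : TwoMatrix N} (c : ℂ) (X : Matrix (Fin N) (Fin N) B) :
    rTrace Ψ (c • X) = c • rTrace Ψ X := by
  simp only [rTrace, Matrix.smul_apply, Finset.smul_sum, smul_comm c]

/-- The normalized skew-symmetric powers of the matrix `L`. -/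
def skewMatrix (Ψ : TwoMatrix N) (r : ℂ) (L : Matrix (Fin N) (Fin N) B) :
    ℕ → Matrix (Fin N) (Fin N) B
  | 0 => L
  | k + 1 => L * (Matrix.scalar (Fin N) ((qNum r k)⁻¹ • rTrace Ψ (skewMatrix Ψ r L k)) +
      r • skewMatrix Ψ r L k)

theorem amp_skewMatrix {R S Ψ : TwoMatrix N} {r : ℂ} {L : Matrix (Fin N) (Fin N) B}
    (H : ReflectionTower r (traceMatrix Ψ) (modelUnits N B) R S ((Lens.single N 0).amp L))
    (k : ℕ) : (Lens.single N 0).amp (qFact r k • skewMatrix Ψ r L k) =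
      skewPower r (traceMatrix Ψ) (modelUnits N B) R S ((Lens.single N 0).amp L) k := by
  induction k with
  | zero => simp [qFact, skewMatrix, skewPower_zero]
  | succ k ih =>
    have hk : qNum r k ≠ 0 := fun h => H.qFact_ne_zero (k + 1) (by rw [qFact, h, mul_zero])
    have ht : ∀ (c : ℂ) (x : B),
        Matrix.scalar (Fin N) (c • x) = c • Matrix.scalar (Fin N) x := by
      intro c x
      ext i j
      simp [Matrix.diagonal_apply]
    rw [H.skewPower_succ, ← ih, partialTrace_amp, ← map_smul, ← map_add, ← map_mul]
    change _ = (Lens.single N 0).amp (L * (Matrix.scalar (Fin N)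
      (rTrace Ψ (qFact r k • skewMatrix Ψ r L k)) +
        (r * qNum r k) • qFact r k • skewMatrix Ψ r L k))
    rw [rTrace_smul, ht, skewMatrix, ht, qFact, ← mul_smul_comm, smul_add, smul_smul, mul_assoc,
      mul_inv_cancel₀ hk, mul_one, smul_smul, smul_smul]
    congr 4
    ring

/-- By the Newton identities the R-trace of the k-th expression is a multiple of e_{k+1}(μ), exactly
the coefficient of the new lowest term. Only power sums of degree at most m enter. -/
theorem skewMatrix_eq {Ψ : TwoMatrix N} {q : ℂ} (hq0 : q ≠ 0) (hq : q ^ 2 ≠ 1)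
    (hn : ∀ k, qNum (-q⁻¹) k ≠ 0) {L : Matrix (Fin N) (Fin N) B} {m : ℕ}
    {μ : Fin m → ℂ}
    (hp : ∀ k, 1 ≤ k → k ≤ m → rTrace Ψ (L ^ k) = algebraMap ℂ B (alpha q μ k))
    (k : ℕ) (hk : k ≤ m) : skewMatrix Ψ (-q⁻¹) L k =
      (-q⁻¹) ^ k • ∑ j ∈ Finset.range (k + 1), signedElem μ j • L ^ (k + 1 - j) := by
  induction k with
  | zero => simp [skewMatrix, signedElem_zero]
  | succ k ih =>
    have ih := ih (by omega)
    have ht : rTrace Ψ (skewMatrix Ψ (-q⁻¹) L k) =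
        algebraMap ℂ B ((-q⁻¹) ^ k * (-q⁻¹ * qNum (-q⁻¹) k * signedElem μ (k + 1))) := by
      rw [ih, rTrace_smul, rTrace_sum, ← sum_signedElem_mul_alpha hq0 hq, map_mul, map_sum,
        ← Algebra.smul_def]
      congr 1
      refine Finset.sum_congr rfl fun j hj => ?_
      have := Finset.mem_range.1 hj
      rw [rTrace_smul, hp _ (by omega) (by omega), map_mul, ← Algebra.smul_def]
    have hs : Matrix.scalar (Fin N) ((qNum (-q⁻¹) k)⁻¹ • rTrace Ψ (skewMatrix Ψ (-q⁻¹) L k)) =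
        ((-q⁻¹) ^ (k + 1) * signedElem μ (k + 1)) • (1 : Matrix (Fin N) (Fin N) B) := by
      have hkk := hn k
      rw [ht, Algebra.smul_def, ← map_mul, show (qNum (-q⁻¹) k)⁻¹ *
        ((-q⁻¹) ^ k * (-q⁻¹ * qNum (-q⁻¹) k * signedElem μ (k + 1))) =
        (-q⁻¹) ^ (k + 1) * signedElem μ (k + 1) by
          rw [pow_succ]
          generalize qNum (-q⁻¹) k = y at hkk
          generalize -q⁻¹ = r
          field_simp]
      ext i j
      simp [Matrix.diagonal_apply, Matrix.one_apply, Algebra.smul_def]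
    rw [skewMatrix, hs, ih, mul_add, mul_smul_comm, mul_one, smul_smul, ← pow_succ',
      mul_smul_comm, Finset.mul_sum, Finset.sum_range_succ _ (k + 1), smul_add, add_comm,
      mul_smul]
    congr 2
    · refine Finset.sum_congr rfl fun j hj => ?_
      have := Finset.mem_range.1 hj
      rw [mul_smul_comm, ← pow_succ', show k + 1 - j + 1 = k + 1 + 1 - j by omega]
    · rw [show k + 1 + 1 - (k + 1) = 1 by omega, pow_one]

/-- The power sums of degree larger than `m` are determined by the Cayley-Hamilton identity. -/
theorem rTrace_pow {R Ψ : TwoMatrix N} {q : ℂ} (hR : IsHeckeSymmetry R q)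
    (hΨ : IsSkewInverse R Ψ) {L : Matrix (Fin N) (Fin N) B}
    (hL : R.map (algebraMap ℂ B) * kroneckerMap (· * ·) L 1 * R.map (algebraMap ℂ B) *
        kroneckerMap (· * ·) L 1 =
      kroneckerMap (· * ·) L 1 * R.map (algebraMap ℂ B) * kroneckerMap (· * ·) L 1 *
        R.map (algebraMap ℂ B)) {m : ℕ} {μ : Fin m → ℂ} (hm : HasBiRank R q m 0)
    (hp : ∀ k, 1 ≤ k → k ≤ m → rTrace Ψ (L ^ k) = algebraMap ℂ B (alpha q μ k))
    (k : ℕ) (hk : 1 ≤ k) : rTrace Ψ (L ^ k) = algebraMap ℂ B (alpha q μ k) := by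
  have H := hR.reflectionTower hΨ hL
  -- The antisymmetrizer on m + 1 factors vanishes, and `skewMatrix` with index m involves m + 1
  -- factors.
  have hsk : skewMatrix Ψ (-q⁻¹) L m = 0 := by
    rcases Nat.eq_zero_or_pos N with rfl | hN
    · exact Subsingleton.elim _ _
    have : Nonempty (ℕ → Fin N) := ⟨fun _ => ⟨0, hN⟩⟩
    have h1 := amp_skewMatrix H m
    rw [skewPower, eq_zero_of_skewRelations_eq_top hm.skewRelations.1 fun j hj =>
      H.antisym_mul 0 (m + 1) j (by omega) (by omega), mul_zero, map_zero,
      ← map_zero (Lens.single N 0).amp] at h1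
    exact (smul_eq_zero_iff_right (hR.qFact_ne_zero m)).1 ((Lens.single N 0).amp_injective h1)
  rw [skewMatrix_eq hR.q_ne_zero hR.sq_ne_one hR.qNum_ne_zero hp m le_rfl,
    smul_eq_zero_iff_right (pow_ne_zero _ (neg_ne_zero.2 (inv_ne_zero hR.q_ne_zero)))] at hsk
  induction k using Nat.strong_induction_on with
  | _ k ih =>
  rcases le_or_gt k m with hkm | hkm
  · exact hp k hk hkm
  obtain ⟨l, rfl⟩ : ∃ l, k = m + 1 + l := ⟨k - (m + 1), by omega⟩
  have h1 : ∑ j ∈ Finset.range (m + 1), signedElem μ j • rTrace Ψ (L ^ (m + 1 + l - j)) = 0 := by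
    have h2 := congrArg (fun X => rTrace Ψ (X * L ^ l)) hsk
    simp only [Finset.sum_mul, zero_mul, rTrace_sum] at h2
    have h0 : rTrace Ψ (0 : Matrix (Fin N) (Fin N) B) = 0 := by simp [rTrace]
    rw [h0] at h2
    rw [← h2]
    refine Finset.sum_congr rfl fun j hj => ?_
    have := Finset.mem_range.1 hj
    rw [smul_mul_assoc, rTrace_smul, ← pow_add, show m + 1 - j + l = m + 1 + l - j by omega]
  -- The α_k obey the same recursion: beyond degree m the elementary symmetric functions in the
  -- Newton identity are zero.
  have h2 : ∑ j ∈ Finset.range (m + 1), signedElem μ j * alpha q μ (m + 1 + l - j) = 0 := by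
    have h3 := sum_signedElem_mul_alpha hR.q_ne_zero hR.sq_ne_one μ (m + l)
    rw [signedElem_of_lt μ (by omega), mul_zero] at h3
    rw [← h3, show m + l + 1 = m + 1 + l by omega]
    refine Finset.sum_subset (Finset.range_mono (by omega)) fun j _ hj => ?_
    rw [signedElem_of_lt μ (by simpa using hj), zero_mul]
  rw [Finset.sum_range_succ', signedElem_zero, one_smul, Nat.sub_zero] at h1
  rw [Finset.sum_range_succ', signedElem_zero, one_mul, Nat.sub_zero] at h2
  rw [eq_neg_of_add_eq_zero_right h1, eq_neg_of_add_eq_zero_right h2, map_neg, map_sum]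
  congr 1
  refine Finset.sum_congr rfl fun j hj => ?_
  have := Finset.mem_range.1 hj
  rw [ih _ (by omega) (by omega), map_mul, Algebra.smul_def]

end CayleyHamilton

/-! ### The orbit -/

/-- The quotient by a submodule with a coordinate system is projective. -/
theorem projective_quotient_span {A P : Type*} [Ring A] [AddCommGroup P] [Module A P]
    [Module.Projective A P] {m : ℕ} (e : Fin m → P) (φ : P →ₗ[A] (Fin m → A))
    (h : ∀ i, φ (e i) = Pi.single i 1) :
    Module.Projective A (P ⧸ Submodule.span A (Set.range e)) := by
  set W := Submodule.span A (Set.range e)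
  let ψ : (Fin m → A) →ₗ[A] P := Fintype.linearCombination A e
  have hψ : ∀ c, ψ c ∈ W := fun c => by
    rw [Fintype.linearCombination_apply]
    exact Submodule.sum_mem _ fun i _ => Submodule.smul_mem _ _ (Submodule.subset_span ⟨i, rfl⟩)
  -- ψ ∘ φ fixes the generators, so it is a projection onto `W`, and the complementary projection
  -- descends to a section of the quotient map.
  have hker : W ≤ LinearMap.ker (LinearMap.id - ψ ∘ₗ φ) := by
    refine Submodule.span_le.2 ?_
    rintro _ ⟨i, rfl⟩
    simp [ψ, h, Fintype.linearCombination_apply_single]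
  refine Module.Projective.of_split (W.liftQ _ hker) W.mkQ (LinearMap.ext fun x => ?_)
  obtain ⟨x, rfl⟩ := W.mkQ_surjective x
  simp only [LinearMap.comp_apply, Submodule.mkQ_apply, Submodule.liftQ_apply,
    LinearMap.sub_apply, LinearMap.id_apply, Submodule.Quotient.mk_sub]
  rw [(Submodule.Quotient.mk_eq_zero W).2 (hψ _), sub_zero]

instance free_op (A : Type*) [Ring A] : Module.Free Aᵐᵒᵖ A :=
  let e : Aᵐᵒᵖ ≃ₗ[Aᵐᵒᵖ] A :=
    { toFun := MulOpposite.unop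
      invFun := MulOpposite.op
      map_add' := fun _ _ => rfl
      map_smul' := fun _ _ => rfl
      left_inv := fun _ => rfl
      right_inv := fun _ => rfl }
  Module.Free.of_equiv e

section Orbit

variable {N : ℕ} (R Ψ : TwoMatrix N) (q : ℂ) {m : ℕ} (μ : Fin m → ℂ)

theorem orbitL_reflection :
    R.map (algebraMap ℂ (Orbit R Ψ q μ)) * kroneckerMap (· * ·) (orbitL R Ψ q μ) 1 *
        R.map (algebraMap ℂ (Orbit R Ψ q μ)) * kroneckerMap (· * ·) (orbitL R Ψ q μ) 1 =
      kroneckerMap (· * ·) (orbitL R Ψ q μ) 1 * R.map (algebraMap ℂ (Orbit R Ψ q μ)) *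
        kroneckerMap (· * ·) (orbitL R Ψ q μ) 1 * R.map (algebraMap ℂ (Orbit R Ψ q μ)) := by
  set f : FreeAlgebra ℂ (Fin N × Fin N) →ₐ[ℂ] Orbit R Ψ q μ :=
    (Orbit.mk R Ψ q μ).comp (REAlgebra.mk R)
  have h : f.mapMatrix (freeR R * freeL₁ N * freeR R * freeL₁ N) =
      f.mapMatrix (freeL₁ N * freeR R * freeL₁ N * freeR R) := by
    ext x y
    exact congrArg (Orbit.mk R Ψ q μ) (RingQuot.mkAlgHom_rel ℂ (RERel.entry x y))
  have hL : f.mapMatrix (freeL₁ N) = kroneckerMap (· * ·) (orbitL R Ψ q μ) 1 := by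
    ext x y
    simp only [freeL₁, AlgHom.mapMatrix_apply, Matrix.map_apply, kroneckerMap_apply, map_mul,
      Matrix.one_apply, apply_ite f, map_one, map_zero]
    rfl
  have hR : f.mapMatrix (freeR R) = R.map (algebraMap ℂ (Orbit R Ψ q μ)) := by
    ext x y
    exact f.commutes _
  simpa only [map_mul, hL, hR] using h

theorem rTrace_orbitL_pow (n : Fin m) : rTrace Ψ (orbitL R Ψ q μ ^ ((n : ℕ) + 1)) =
    algebraMap ℂ (Orbit R Ψ q μ) (alpha q μ ((n : ℕ) + 1)) := by
  have h := RingQuot.mkAlgHom_rel ℂ (OrbitRel.powerSum (R := R) (Ψ := Ψ) (q := q) (μ := μ) n)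
  have h1 : orbitL R Ψ q μ ^ ((n : ℕ) + 1) =
      (Orbit.mk R Ψ q μ).mapMatrix (genL R ^ ((n : ℕ) + 1)) := by
    rw [map_pow]; rfl
  have h2 : rTrace Ψ (orbitL R Ψ q μ ^ ((n : ℕ) + 1)) =
      Orbit.mk R Ψ q μ (rTrace Ψ (genL R ^ ((n : ℕ) + 1))) := by
    simp only [h1, rTrace, map_sum, map_smul]; rfl
  rw [h2, ← (Orbit.mk R Ψ q μ).commutes]
  exact h

/-- The pairing of one-forms with the matrix `X`: it replaces `dL` by `X`. -/
def pairing (X : Matrix (Fin N) (Fin N) (Orbit R Ψ q μ)) :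
    FreeForms R Ψ q μ →ₗ[(Orbit R Ψ q μ)ᵐᵒᵖ] (Orbit R Ψ q μ)ᵐᵒᵖ where
  toFun f := MulOpposite.op (∑ p, X p.1 p.2 * f p)
  map_add' f g := by simp [mul_add, Finset.sum_add_distrib]
  map_smul' c f := MulOpposite.unop_injective (by simp [Finset.sum_mul, mul_assoc])

theorem pairing_dPowerSum (X : Matrix (Fin N) (Fin N) (Orbit R Ψ q μ)) (n : ℕ) :
    pairing R Ψ q μ X (dPowerSum R Ψ q μ n) =
      MulOpposite.op (rTrace Ψ (X * orbitL R Ψ q μ ^ n)) := by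
  have hs : ∀ (c : ℂ) f, pairing R Ψ q μ X (c • f) = c • pairing R Ψ q μ X f := by
    intro c f
    simp [pairing, Finset.smul_sum]
  simp only [dPowerSum, rTrace, map_sum, hs, Finset.op_sum, MulOpposite.op_smul]
  refine Finset.sum_congr rfl fun i _ => Finset.sum_congr rfl fun j _ => ?_
  congr 1
  rw [dLMul, Matrix.of_apply, map_sum, Matrix.mul_apply, Finset.op_sum]
  refine Finset.sum_congr rfl fun a _ => congrArg MulOpposite.op ?_
  rw [Finset.sum_eq_single (j, a)]
  · simp
  · intro p _ hp
    rw [Pi.single_eq_of_ne hp, mul_zero]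
  · simp

theorem rTrace_orbitL {R Ψ : TwoMatrix N} {q : ℂ} (hR : IsHeckeSymmetry R q)
    (hΨ : IsSkewInverse R Ψ) {μ : Fin m → ℂ} (hm : HasBiRank R q m 0) (h0 : 0 < m) (k : ℕ) :
    rTrace Ψ (orbitL R Ψ q μ ^ k) = algebraMap ℂ (Orbit R Ψ q μ) (powerSum q μ k) := by
  rcases Nat.eq_zero_or_pos k with rfl | hk
  · rw [powerSum, if_pos rfl, ← hR.trace_traceMatrix hΨ h0 hm.skewRelations.1
      (hm.skewRelations.2 h0), pow_zero]
    simp [rTrace, Matrix.one_apply, Matrix.trace, Algebra.smul_def]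
  · rw [powerSum, if_neg hk.ne']
    refine rTrace_pow hR hΨ (orbitL_reflection R Ψ q μ) hm (fun k h1 h2 => ?_) k hk
    have := rTrace_orbitL_pow R Ψ q μ ⟨k - 1, by omega⟩
    simpa only [Nat.sub_add_cancel h1] using this

end Orbit

end Braided

end

theorem mainTheorem4 (N m : ℕ) (q : ℂ) (R Ψ : Braided.TwoMatrix N)
    (hR : Braided.IsHeckeSymmetry R q) (hΨ : Braided.IsSkewInverse R Ψ)
    (hm : Braided.HasBiRank R q m 0)
    (μ : Fin m → ℂ) (hμ : ∀ i j : Fin m, i ≠ j → μ i ≠ q ^ 2 * μ j) :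
    Module.Projective (Braided.Orbit R Ψ q μ)ᵐᵒᵖ (Braided.OneForms R Ψ q μ) := by
  classical
  rcases Nat.eq_zero_or_pos m with rfl | h0
  -- There are no relations, so the zero map is a coordinate system.
  · exact Braided.projective_quotient_span _ 0 fun i => i.elim0
  have hH := Braided.isUnit_det_hankel hR.q_ne_zero hR.sq_ne_one μ h0 hμ
  -- The i-th coordinate replaces dL by ∑_j (H⁻¹)_{ij} L^j. On the n-th relation it takes the value
  -- ∑_j (H⁻¹)_{ij} Tr_R L^(j+n) = (H⁻¹ H)_{in}.
  refine Braided.projective_quotient_span _ (LinearMap.pi fun i => Braided.pairing R Ψ q μ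
    (∑ j, (Braided.hankel q μ)⁻¹ i j • Braided.orbitL R Ψ q μ ^ (j : ℕ))) fun n => ?_
  funext i
  rw [LinearMap.pi_apply, Braided.pairing_dPowerSum, Finset.sum_mul, Braided.rTrace_sum]
  have h : ∀ j : Fin m, Braided.rTrace Ψ ((Braided.hankel q μ)⁻¹ i j •
      Braided.orbitL R Ψ q μ ^ (j : ℕ) * Braided.orbitL R Ψ q μ ^ (n : ℕ)) =
      algebraMap ℂ _ ((Braided.hankel q μ)⁻¹ i j * Braided.hankel q μ j n) := fun j => by
    rw [smul_mul_assoc, Braided.rTrace_smul, ← pow_add, Braided.rTrace_orbitL hR hΨ hm h0,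
      Algebra.smul_def, ← map_mul]
    rfl
  rw [Finset.sum_congr rfl fun j _ => h j, ← map_sum, ← Matrix.mul_apply,
    Matrix.nonsing_inv_mul _ hH, Matrix.one_apply, Pi.single_apply]
  split_ifs <;> simp
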